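/- Let $n\ge 0$, let $\mathbb F=\mathbb Q(q,t)$ and $\mathbb K=\mathbb Q(q,t,a)$ with $q,t,a$ independent variables, and let $\mathcal P_n$ be the set of partitions $\lambda=(\lambda_1\ge\cdots\ge\lambda_n\ge 0)$ with at most $n$ parts, $|\lambda|=\lambda_1+\cdots+\lambda_n$. Put $\tau=(\tau_1,\ldots,\tau_n)$ with $\tau_i=t^{1-i}$ and, for $\mu\in\mathcal P_n$, $$\overline\mu=(q^{\mu_1}\tau_1,\ldots,q^{\mu_n}\tau_n),\qquad \widetilde\mu=(q^{-\mu_n}\tau_1,\ldots,q^{-\mu_1}\tau_n),\qquad \overline\mu^{-1}=(\overline\mu_1^{-1},\ldots,\overline\mu_n^{-1}).$$ For every $\lambda\in\mathcal P_n$ there is exactly one symmetric polynomial $R_\lambda\in\mathbb F[x_1,\ldots,x_n]$ of degree at most $|\lambda|$ such that $R_\lambda(\overline\mu)=0$ for all $\mu\in\mathcal P_n$ with $|\mu|\le|\lambda|$ and $\mu\ne\lambda$, and such that the coefficient of $x^\lambda=x_1^{\lambda_1}\cdots x_n^{\lambda_n}$ in $R_\lambda$ is $1$ (the symmetric interpolation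 Macdonald polynomial). Moreover $R_\lambda(a\tau)\ne 0$ in $\mathbb K$, so that the normalized polynomial $$K^+_\lambda(x)=\frac{R_\lambda(x)}{R_\lambda(a\tau)}\in\mathbb K[x_1,\ldots,x_n]$$ is well defined. Okounkov duality: for all $\lambda,\mu\in\mathcal P_n$, $$K^+_\lambda(a\widetilde\mu)=K^+_\mu(a\widetilde\lambda),$$ and also, in the equivalent form, $$K^+_\lambda\bigl(t^{1-n}a\,\overline\mu^{-1}\bigr)=K^+_\mu\bigl(t^{1-n}a\,\overline\lambda^{-1}\bigr).$$ -/

import Mathlib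

namespace InterpolationMacdonald

/-- The field `𝔽 = ℚ(q, t)` of rational functions in two independent variables. -/
abbrev BaseField : Type := FractionRing (MvPolynomial (Fin 2) ℚ)

/-- The field `𝕂 = ℚ(q, t, a) = 𝔽(a)`. -/
abbrev BigField : Type := RatFunc BaseField

/-- The variable `q` of `𝔽`. -/
noncomputable def q : BaseField :=
  algebraMap (MvPolynomial (Fin 2) ℚ) BaseField (MvPolynomial.X 0)

/-- The variable `t` of `𝔽`. -/
noncomputable def t : BaseField :=
  algebraMap (MvPolynomial (Fin 2) ℚ) BaseField (MvPolynomial.X 1)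

/-- The variable `a` of `𝕂`. -/
noncomputable def a : BigField := RatFunc.X

/-- Partitions with at most `n` parts: weakly decreasing sequences of `n` natural numbers. -/
def Partitions (n : ℕ) : Type := {lam : Fin n → ℕ // Antitone lam}

namespace Partitions

/-- The size `|λ| = λ₁ + ⋯ + λₙ`. -/
def size {n : ℕ} (lam : Partitions n) : ℕ := ∑ i, lam.1 i

end Partitions

/-- The vector `τ = (1, t⁻¹, …, t^(1-n))`; the index `i : Fin n` starts at `0`. -/
noncomputable def tau {n : ℕ} (i : Fin n) : BaseField := t ^ (-(i.val : ℤ))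

/-- The vector with entries `q^(μ_i) τ_i`. -/
noncomputable def bar {n : ℕ} (mu : Partitions n) (i : Fin n) : BaseField :=
  q ^ mu.1 i * tau i

/-- The vector `(q^(-μ_n) τ_1, …, q^(-μ_1) τ_n)`. -/
noncomputable def tilde {n : ℕ} (mu : Partitions n) (i : Fin n) : BaseField :=
  q ^ (-(mu.1 i.rev : ℤ)) * tau i

/-- `R` is a symmetric polynomial over `𝔽` of degree at most `|λ|`, vanishing at all points
`bar μ` with `|μ| ≤ |λ|` and `μ ≠ λ`, whose coefficient of `x^λ` is `1`. -/
structure IsSymInterpolation {n : ℕ} (lam : Partitions n)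
    (R : MvPolynomial (Fin n) BaseField) : Prop where
  symmetric : R.IsSymmetric
  degree_le : R.totalDegree ≤ lam.size
  vanishing : ∀ mu : Partitions n, mu.size ≤ lam.size → mu ≠ lam →
    MvPolynomial.eval (bar mu) R = 0
  coeff_eq_one : MvPolynomial.coeff (Finsupp.equivFunOnFinite.symm lam.1) R = 1

open Classical in
/-- The symmetric interpolation Macdonald polynomial `R_λ(x; q, t) ∈ 𝔽[x]`: the polynomial
with the defining properties above (the value `0` would be taken if there were none). -/
noncomputable def symInterpolation {n : ℕ} (lam : Partitions n) :
    MvPolynomial (Fin n) BaseField :=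
  if h : ∃ R, IsSymInterpolation lam R then h.choose else 0

/-- `R_λ` viewed in `𝕂[x]`. -/
noncomputable def symInterpolationK {n : ℕ} (lam : Partitions n) :
    MvPolynomial (Fin n) BigField :=
  MvPolynomial.map (algebraMap BaseField BigField) (symInterpolation lam)

/-- The point `a y ∈ 𝕂ⁿ` for `y ∈ 𝔽ⁿ`. -/
noncomputable def scaleA {n : ℕ} (y : Fin n → BaseField) (i : Fin n) : BigField :=
  a * algebraMap BaseField BigField (y i)

/-- The normalized polynomial `K⁺_λ(x) = R_λ(x) / R_λ(a τ) ∈ 𝕂[x]`. -/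
noncomputable def Kplus {n : ℕ} (lam : Partitions n) : MvPolynomial (Fin n) BigField :=
  MvPolynomial.C (MvPolynomial.eval (scaleA tau) (symInterpolationK lam))⁻¹ *
    symInterpolationK lam

end InterpolationMacdonald

/-!
Let `τ = (1, t⁻¹, …, t^(1-n))` and `μ̄ = (q^(μ_i) τ_i)`. A symmetric polynomial of degree at
most `d` that vanishes at `μ̄` for all `|μ| ≤ d` is zero, by induction on `d` and `n`, so
interpolation at these points has a unique solution by a dimension count.

Consider the `q`-difference operators `D(u)` on symmetric polynomials that send `f` to a
combination of its values at the points obtained from `x` by dividing the coordinates in a set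
`I` by `q`. The coefficients vanish at `x = μ̄` unless `I` is a vertical strip that can be
removed from `μ`, so `D(u)` preserves the vanishing conditions and `R_λ` is an eigenfunction,
with eigenvalue `∏ (1 + u / λ̄_i)`. The coefficients of the powers of `u` in the eigenvalue
equation at `x = σ̄` give a recurrence, which shows that for `ρ` contained in the rectangle
`(Nⁿ)` the function `λ ↦ R_λ(ρ̄) / R_λ(q^N τ)` is a symmetric polynomial in `λ̄⁻¹` of degree at
most `n N - |ρ|`.

If `ρ` is the complement of `μ` in the rectangle, this polynomial, evaluated at the complements
of the `λ`, has the degree and the zeros that characterize `R_μ` up to a scalar. This is the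
duality at `a = q^N`. Both sides, cleared of denominators, are polynomials in `a`, and they
agree for all large `N`.
-/

namespace InterpolationMacdonald

open MvPolynomial

section LinearFactors

variable {σ ρ R F : Type*} [CommRing R] [Field F]

theorem totalDegree_aeval_le (v : σ → MvPolynomial ρ R) (hv : ∀ i, (v i).totalDegree ≤ 1)
    (f : MvPolynomial σ R) : (aeval v f).totalDegree ≤ f.totalDegree := by
  conv_lhs => rw [f.as_sum, map_sum]
  refine totalDegree_finsetSum_le fun s hs => ?_
  rw [aeval_monomial, algebraMap_eq]
  refine (totalDegree_mul _ _).trans ?_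
  rw [totalDegree_C, zero_add, Finsupp.prod]
  refine (totalDegree_finsetProd _ _).trans (le_trans ?_ (le_totalDegree hs))
  refine Finset.sum_le_sum fun i _ => (totalDegree_pow _ _).trans ?_
  simpa using Nat.mul_le_mul_left (s i) (hv i)

theorem X_sub_dvd_of_aeval_update [DecidableEq σ] (i : σ) (p f : MvPolynomial σ R)
    (h : aeval (Function.update X i p) f = 0) : X i - p ∣ f := by
  have mk_comp_aeval : (Ideal.Quotient.mkₐ R (Ideal.span {X i - p})).comp
      (aeval (Function.update X i p)) = Ideal.Quotient.mkₐ R (Ideal.span {X i - p}) := by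
    refine MvPolynomial.algHom_ext fun j => ?_
    rw [AlgHom.comp_apply, aeval_X]
    rcases eq_or_ne j i with rfl | hj
    · rw [Function.update_self, eq_comm]
      exact Ideal.Quotient.eq.2 (Ideal.subset_span rfl)
    · rw [Function.update_of_ne hj]
  have mk_eq_zero := DFunLike.congr_fun mk_comp_aeval f
  rw [AlgHom.comp_apply, h, map_zero] at mk_eq_zero
  exact Ideal.mem_span_singleton.1 (Ideal.Quotient.eq_zero_iff_mem.1 mk_eq_zero.symm)

theorem totalDegree_X_sub [Nontrivial R] (i : σ) (p : MvPolynomial σ R) (hp : p.totalDegree ≤ 1)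
    (hi : coeff (Finsupp.single i 1) p = 0) : (X i - p).totalDegree = 1 := by
  classical
  refine le_antisymm ((totalDegree_sub _ _).trans (by simpa using hp)) ?_
  have single_mem : Finsupp.single i 1 ∈ (X i - p).support := by
    rw [mem_support_iff, coeff_sub, hi, coeff_X, if_pos rfl]
    simp
  simpa using le_totalDegree single_mem

theorem totalDegree_X_sub_C [Nontrivial R] (i : σ) (c : R) :
    (X i - C c : MvPolynomial σ R).totalDegree = 1 := by
  classical
  refine totalDegree_X_sub i _ (by simp) ?_
  rw [coeff_C, if_neg (Finsupp.single_ne_zero.2 one_ne_zero).symm]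

theorem totalDegree_X_sub_X [Nontrivial R] {i j : σ} (h : i ≠ j) :
    (X i - X j : MvPolynomial σ R).totalDegree = 1 := by
  refine totalDegree_X_sub i _ (by simp) ?_
  classical
  rw [coeff_X, if_neg fun hij => h (Finsupp.single_left_injective one_ne_zero hij).symm]

theorem isRelPrime_of_totalDegree_eq_one {L M : MvPolynomial σ F} (hL : L.totalDegree = 1)
    {v : σ → F} (hvL : eval v L = 0) (hvM : eval v M ≠ 0) : IsRelPrime L M := by
  have irreducible_L : Irreducible L := by
    refine irreducible_of_totalDegree_eq_one hL fun x hx => isUnit_iff_ne_zero.2 ?_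
    rintro rfl
    have L_eq_zero : L = 0 := by
      ext m
      simpa using hx m
    simp [L_eq_zero] at hL
  refine irreducible_L.isRelPrime_iff_not_dvd.2 ?_
  rintro ⟨g, rfl⟩
  exact hvM (by rw [map_mul, hvL, zero_mul])

theorem totalDegree_prod_eq_card [IsDomain R] {ι : Type*} (s : Finset ι)
    (L : ι → MvPolynomial σ R)
    (hL : ∀ i ∈ s, (L i).totalDegree = 1) : (∏ i ∈ s, L i).totalDegree = s.card := by
  classical
  induction s using Finset.induction_on with
  | empty => simp
  | insert i s hi ih =>
    have hne : ∀ j ∈ insert i s, L j ≠ 0 := fun j hj h0 => by simpa [h0] using hL j hj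
    rw [Finset.prod_insert hi, totalDegree_mul_of_isDomain (hne i (Finset.mem_insert_self i s))
      (Finset.prod_ne_zero_iff.2 fun j hj => hne j (Finset.mem_insert_of_mem hj)),
      hL i (Finset.mem_insert_self i s), ih fun j hj => hL j (Finset.mem_insert_of_mem hj),
      Finset.card_insert_of_notMem hi, add_comm]

theorem prod_X_sub_C_dvd [Fintype σ] [DecidableEq σ] (c : F) {f : MvPolynomial σ F}
    (h : ∀ i, aeval (Function.update X i (C c)) f = 0) : ∏ i, (X i - C c) ∣ f := by
  refine Finset.prod_dvd_of_isRelPrime (fun i _ j _ hij => ?_)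
    fun i _ => X_sub_dvd_of_aeval_update i _ f (h i)
  exact isRelPrime_of_totalDegree_eq_one (totalDegree_X_sub_C i c)
    (v := Function.update (fun _ => c + 1) i c) (by simp)
    (by simp [Function.update_of_ne hij.symm])

variable {n : ℕ}

theorem det_vandermonde_dvd {f : MvPolynomial (Fin n) F}
    (h : ∀ i j, i < j → aeval (Function.update X j (X i : MvPolynomial (Fin n) F)) f = 0) :
    (Matrix.vandermonde (X : Fin n → MvPolynomial (Fin n) F)).det ∣ f := by
  rw [Matrix.det_vandermonde, Finset.prod_sigma']
  refine Finset.prod_dvd_of_isRelPrime ?_ ?_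
  · rintro ⟨i, j⟩ hij ⟨k, l⟩ hkl hne
    simp only [Finset.coe_sigma, Set.mem_sigma_iff, Finset.mem_coe, Finset.mem_univ,
      Finset.mem_Ioi, true_and] at hij hkl
    obtain ⟨m, hmi, hmj, hm⟩ : ∃ m, m ≠ i ∧ m ≠ j ∧ (m = k ∨ m = l) := by
      have pair_ne : ¬ (i = k ∧ j = l) := by
        rintro ⟨rfl, rfl⟩
        exact hne rfl
      by_contra! hcon
      have hk := hcon k
      have hl := hcon l
      grind
    refine isRelPrime_of_totalDegree_eq_one (totalDegree_X_sub_X hij.ne')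
      (v := Pi.single m 1) (by simp [hmi.symm, hmj.symm]) ?_
    rcases hm with rfl | rfl <;> simp [hkl.ne, hkl.ne']
  · rintro ⟨i, j⟩ hij
    simp only [Finset.mem_sigma, Finset.mem_univ, Finset.mem_Ioi, true_and] at hij
    exact X_sub_dvd_of_aeval_update j (X i) f (h i j hij)

theorem prod_X_mul_det_vandermonde_dvd {f : MvPolynomial (Fin n) F}
    (h_zero : ∀ i, aeval (Function.update X i (0 : MvPolynomial (Fin n) F)) f = 0)
    (h_eq : ∀ i j, i < j → aeval (Function.update X j (X i : MvPolynomial (Fin n) F)) f = 0) :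
    (∏ i, X i : MvPolynomial (Fin n) F) * (Matrix.vandermonde X).det ∣ f := by
  obtain ⟨g, rfl⟩ : (∏ i, X i : MvPolynomial (Fin n) F) ∣ f := by
    simpa using prod_X_sub_C_dvd (0 : F) (by simpa using h_zero)
  refine mul_dvd_mul_left _ (det_vandermonde_dvd fun i j hij => ?_)
  have aeval_mul_eq_zero := h_eq i j hij
  rw [map_mul, map_prod] at aeval_mul_eq_zero
  refine (mul_eq_zero.1 aeval_mul_eq_zero).resolve_left
    (Finset.prod_ne_zero_iff.2 fun k _ => ?_)
  rcases eq_or_ne k j with rfl | hk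
  · simp
  · simp [Function.update_of_ne hk]

end LinearFactors

section Symmetry

variable {σ R A : Type*} [CommRing R] [CommRing A] {n : ℕ}

theorem aeval_comp_perm [Algebra R A] {f : MvPolynomial σ R} (hf : f.IsSymmetric)
    (e : Equiv.Perm σ) (v : σ → A) : aeval (v ∘ e) f = aeval v f := by
  conv_rhs => rw [← hf e, aeval_rename]

theorem rename_eq_of_mul_left [IsDomain R] {e : Equiv.Perm σ} {ε : ℤˣ}
    {P g : MvPolynomial σ R} (hP : P ≠ 0) (h : rename e P = ε • P)
    (hg : rename e (P * g) = ε • (P * g)) : rename e g = g := by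
  rw [map_mul, h, smul_mul_assoc] at hg
  exact mul_left_cancel₀ hP (smul_left_cancel ε hg)

theorem det_vandermonde_comp_perm (e : Equiv.Perm (Fin n)) (v : Fin n → A) :
    (Matrix.vandermonde (v ∘ e)).det = Equiv.Perm.sign e • (Matrix.vandermonde v).det := by
  rw [Units.smul_def, zsmul_eq_mul, ← Matrix.det_permute]
  rfl

theorem map_det_vandermonde {B : Type*} [CommRing B] [Algebra R A] [Algebra R B]
    (φ : A →ₐ[R] B) (v : Fin n → A) :
    φ (Matrix.vandermonde v).det = (Matrix.vandermonde (φ ∘ v)).det := by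
  simp [Matrix.det_vandermonde, map_prod]

theorem rename_det_vandermonde (e : Equiv.Perm (Fin n)) :
    rename e (Matrix.vandermonde (X : Fin n → MvPolynomial (Fin n) R)).det =
      Equiv.Perm.sign e • (Matrix.vandermonde X).det := by
  rw [map_det_vandermonde, ← det_vandermonde_comp_perm]
  congr 2
  funext i
  simp

end Symmetry

section DifferenceOperator

variable {R A : Type*} [CommRing R] [CommRing A] [Algebra R A] {n : ℕ}

/-- The vector obtained from `v` by multiplying the entries at the positions in `I` by `c`. -/
def scaleOn (c : R) (I : Finset (Fin n)) (v : Fin n → A) (i : Fin n) : A :=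
  (if i ∈ I then c else 1) • v i

/-- The coefficient with which the difference operator shifts the variables in `I`, after
multiplication by the Vandermonde determinant: `b` is the factor `t⁻¹` of the Macdonald operators,
and `κ = t ^ (n - 1)` is chosen so that the coefficient vanishes at `τ`. -/
noncomputable def shiftCoeff (κ b : R) (v : Fin n → A) (I : Finset (Fin n)) : A :=
  (∏ i ∈ I, (κ • v i - 1)) * (Matrix.vandermonde (scaleOn b I v)).det

/-- The summand of `shiftSum` in which the variables in `I` are multiplied by `c`. -/
noncomputable def shiftTerm (u κ b c : R) (f : MvPolynomial (Fin n) R) (v : Fin n → A)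
    (I : Finset (Fin n)) : A :=
  algebraMap R A u ^ I.card * (∏ i ∈ Iᶜ, (v i + algebraMap R A u)) * shiftCoeff κ b v I *
    aeval (scaleOn c I v) f

/-- The product of `∏ i, v i`, the Vandermonde determinant of `v` and the value at `v` of `D f`,
where `D` is the generating function in `u` of a commuting family of difference operators that is
diagonal on the symmetric interpolation polynomials. -/
noncomputable def shiftSum (u κ b c : R) (f : MvPolynomial (Fin n) R) (v : Fin n → A) : A :=
  ∑ I, shiftTerm u κ b c f v I

theorem comp_scaleOn {B : Type*} [CommRing B] [Algebra R B] (φ : A →ₐ[R] B) (c : R)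
    (I : Finset (Fin n)) (v : Fin n → A) : φ ∘ scaleOn c I v = scaleOn c I (φ ∘ v) := by
  funext i
  simp only [Function.comp_apply, scaleOn, map_smul]

theorem scaleOn_comp_perm (c : R) (I : Finset (Fin n)) (v : Fin n → A)
    (e : Equiv.Perm (Fin n)) :
    scaleOn c I (v ∘ e) = scaleOn c (I.map e.toEmbedding) v ∘ e := by
  funext i
  simp [scaleOn]

theorem scaleOn_insert_of_eq_zero (c : R) (I : Finset (Fin n)) {v : Fin n → A} {k : Fin n}
    (hv : v k = 0) : scaleOn c (insert k I) v = scaleOn c I v := by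
  funext i
  rcases eq_or_ne i k with rfl | hi
  · simp [scaleOn, hv]
  · simp [scaleOn, hi]

variable (u κ b c : R) (f : MvPolynomial (Fin n) R)

theorem map_shiftCoeff {B : Type*} [CommRing B] [Algebra R B] (φ : A →ₐ[R] B) (v : Fin n → A)
    (I : Finset (Fin n)) : φ (shiftCoeff κ b v I) = shiftCoeff κ b (φ ∘ v) I := by
  simp [shiftCoeff, map_det_vandermonde, comp_scaleOn]

theorem map_shiftSum {B : Type*} [CommRing B] [Algebra R B] (φ : A →ₐ[R] B) (v : Fin n → A) :
    φ (shiftSum u κ b c f v) = shiftSum u κ b c f (φ ∘ v) := by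
  rw [shiftSum, map_sum, shiftSum]
  refine Finset.sum_congr rfl fun I _ => ?_
  have map_aeval : φ (aeval (scaleOn c I v) f) = aeval (scaleOn c I (φ ∘ v)) f := by
    rw [← AlgHom.comp_apply, comp_aeval, ← comp_scaleOn]
    rfl
  simp [shiftTerm, map_shiftCoeff, map_aeval]

theorem shiftCoeff_comp_perm (e : Equiv.Perm (Fin n)) (v : Fin n → A) (I : Finset (Fin n)) :
    shiftCoeff κ b (v ∘ e) I =
      Equiv.Perm.sign e • shiftCoeff κ b v (I.map e.toEmbedding) := by
  rw [shiftCoeff, shiftCoeff, scaleOn_comp_perm, det_vandermonde_comp_perm, mul_smul_comm,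
    Finset.prod_map]
  rfl

variable {f}

theorem shiftTerm_comp_perm (hf : f.IsSymmetric) (e : Equiv.Perm (Fin n)) (v : Fin n → A)
    (I : Finset (Fin n)) :
    shiftTerm u κ b c f (v ∘ e) I =
      Equiv.Perm.sign e • shiftTerm u κ b c f v (I.map e.toEmbedding) := by
  have compl_map : (I.map e.toEmbedding)ᶜ = Iᶜ.map e.toEmbedding := by
    ext i
    simp [Finset.mem_map_equiv]
  rw [shiftTerm, shiftTerm, shiftCoeff_comp_perm, scaleOn_comp_perm, aeval_comp_perm hf, compl_map,
    Finset.prod_map, Finset.card_map, mul_smul_comm, smul_mul_assoc]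
  rfl

theorem shiftSum_comp_perm (hf : f.IsSymmetric) (e : Equiv.Perm (Fin n)) (v : Fin n → A) :
    shiftSum u κ b c f (v ∘ e) = Equiv.Perm.sign e • shiftSum u κ b c f v := by
  rw [shiftSum, shiftSum, Finset.smul_sum]
  exact Fintype.sum_equiv (Equiv.finsetCongr e) _ _ (shiftTerm_comp_perm u κ b c hf e v)

theorem shiftSum_eq_zero_of_eq (hf : f.IsSymmetric) {v : Fin n → A} {i j : Fin n} (hij : i ≠ j)
    (hv : v i = v j) : shiftSum u κ b c f v = 0 := by
  have comp_swap : v ∘ Equiv.swap i j = v := by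
    rw [Equiv.comp_swap_eq_update, hv, Function.update_eq_self, ← hv, Function.update_eq_self]
  refine Finset.sum_involution (fun I _ => I.map (Equiv.swap i j).toEmbedding) (fun I _ => ?_)
    (fun I _ h_ne h_fixed => h_ne ?_) (fun _ _ => Finset.mem_univ _) (fun I _ => ?_)
  · nth_rewrite 1 [← comp_swap]
    rw [shiftTerm_comp_perm u κ b c hf, Equiv.Perm.sign_swap hij]
    simp
  · have mem_iff : i ∈ I ↔ j ∈ I := by
      nth_rewrite 1 [← h_fixed]
      simp
    have det_eq_zero : (Matrix.vandermonde (scaleOn b I v)).det = 0 := by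
      refine Matrix.det_zero_of_row_eq hij (funext fun k => ?_)
      simp only [Matrix.vandermonde_apply, scaleOn, mem_iff, hv]
    rw [shiftTerm, shiftCoeff, det_eq_zero, mul_zero, mul_zero, zero_mul]
  · ext k
    simp [Finset.mem_map_equiv]

variable (f)

theorem shiftTerm_insert_of_eq_zero {v : Fin n → A} {k : Fin n} (hv : v k = 0)
    {I : Finset (Fin n)} (hk : k ∉ I) :
    shiftTerm u κ b c f v (insert k I) = -shiftTerm u κ b c f v I := by
  have compl_eq : Iᶜ = insert k (insert k I)ᶜ := by
    rw [Finset.insert_compl_insert hk]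
  rw [shiftTerm, shiftTerm, shiftCoeff, shiftCoeff, scaleOn_insert_of_eq_zero _ _ hv,
    scaleOn_insert_of_eq_zero _ _ hv, Finset.card_insert_of_notMem hk, Finset.prod_insert hk,
    compl_eq, Finset.prod_insert (by simp), hv, smul_zero]
  ring

theorem shiftSum_eq_zero_of_zero {v : Fin n → A} {k : Fin n} (hv : v k = 0) :
    shiftSum u κ b c f v = 0 := by
  rw [shiftSum, ← Finset.powerset_univ, ← Finset.insert_erase (Finset.mem_univ k),
    Finset.sum_powerset_insert (Finset.notMem_erase k _), ← Finset.sum_add_distrib]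
  refine Finset.sum_eq_zero fun I hI => ?_
  have hk : k ∉ I := fun h => Finset.notMem_erase k _ (Finset.mem_powerset.1 hI h)
  rw [shiftTerm_insert_of_eq_zero u κ b c f hv hk, add_neg_cancel]

end DifferenceOperator

section ShiftSumQuotient

variable {R F : Type*} [CommRing R] [Nontrivial R] [Field F] {n : ℕ}

section Degree

variable (u κ b c : R) (f : MvPolynomial (Fin n) R)

theorem totalDegree_aeval_scaleOn_le (I : Finset (Fin n)) :
    (aeval (scaleOn c I (X : Fin n → MvPolynomial (Fin n) R)) f).totalDegree ≤ f.totalDegree :=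
  totalDegree_aeval_le _ (fun _ => (totalDegree_smul_le _ _).trans (by simp)) f

theorem totalDegree_shiftCoeff_le (I : Finset (Fin n)) :
    (shiftCoeff κ b (X : Fin n → MvPolynomial (Fin n) R) I).totalDegree ≤
      I.card + (Matrix.vandermonde (X : Fin n → MvPolynomial (Fin n) R)).det.totalDegree := by
  refine (totalDegree_mul _ _).trans (add_le_add ?_ ?_)
  · refine (totalDegree_finsetProd _ _).trans ((Finset.sum_le_card_nsmul _ _ 1 fun i _ => ?_).trans
      (by simp))
    refine (totalDegree_sub _ _).trans (max_le ?_ (by simp))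
    exact (totalDegree_smul_le _ _).trans (by simp)
  · have degree_le := totalDegree_aeval_scaleOn_le b
      (Matrix.vandermonde (X : Fin n → MvPolynomial (Fin n) R)).det I
    rwa [map_det_vandermonde, show aeval (scaleOn b I X) ∘ X = scaleOn b I X from
      funext fun i => aeval_X _ i] at degree_le

theorem totalDegree_shiftSum_le :
    (shiftSum u κ b c f (X : Fin n → MvPolynomial (Fin n) R)).totalDegree ≤
      n + (Matrix.vandermonde (X : Fin n → MvPolynomial (Fin n) R)).det.totalDegree +
        f.totalDegree := by
  refine totalDegree_finsetSum_le fun I _ => (totalDegree_mul _ _).trans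
    (add_le_add ((totalDegree_mul _ _).trans ?_) (totalDegree_aeval_scaleOn_le c f I))
  have degree_prod_le : (algebraMap R (MvPolynomial (Fin n) R) u ^ I.card *
      ∏ i ∈ Iᶜ, (X i + algebraMap R (MvPolynomial (Fin n) R) u)).totalDegree ≤ Iᶜ.card := by
    rw [← map_pow, algebraMap_eq]
    refine (totalDegree_mul _ _).trans ?_
    rw [totalDegree_C, zero_add]
    refine (totalDegree_finsetProd _ _).trans
      ((Finset.sum_le_card_nsmul _ _ 1 fun i _ => ?_).trans (by simp))
    exact (totalDegree_add _ _).trans (max_le (by simp) (by simp))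
  have card_add := I.card_compl_add_card
  rw [Fintype.card_fin] at card_add
  have degree_coeff_le := totalDegree_shiftCoeff_le κ b I
  lia

end Degree

variable (u κ b c : F) {f : MvPolynomial (Fin n) F}

theorem exists_isSymmetric_mul_eq_shiftSum (hf : f.IsSymmetric) :
    ∃ g : MvPolynomial (Fin n) F, g.IsSymmetric ∧ g.totalDegree ≤ f.totalDegree ∧
      shiftSum u κ b c f X = (∏ i, X i) * (Matrix.vandermonde X).det * g := by
  obtain ⟨g, hg⟩ : (∏ i, X i : MvPolynomial (Fin n) F) * (Matrix.vandermonde X).det ∣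
      shiftSum u κ b c f X := by
    refine prod_X_mul_det_vandermonde_dvd (fun i => ?_) fun i j hij => ?_
    · rw [map_shiftSum]
      exact shiftSum_eq_zero_of_zero u κ b c f (k := i) (by simp)
    · rw [map_shiftSum]
      exact shiftSum_eq_zero_of_eq u κ b c hf hij.ne (by simp [Function.update_of_ne hij.ne])
  have prod_X_ne_zero : (∏ i, X i : MvPolynomial (Fin n) F) ≠ 0 :=
    Finset.prod_ne_zero_iff.2 fun i _ => X_ne_zero i
  have det_ne_zero : (Matrix.vandermonde (X : Fin n → MvPolynomial (Fin n) F)).det ≠ 0 :=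
    Matrix.det_vandermonde_ne_zero_iff.2 X_injective
  refine ⟨g, fun e => ?_, ?_, hg⟩
  · refine rename_eq_of_mul_left (mul_ne_zero prod_X_ne_zero det_ne_zero)
      (ε := Equiv.Perm.sign e) ?_ ?_
    · simp only [map_mul, map_prod, rename_X, rename_det_vandermonde, mul_smul_comm,
        Equiv.prod_comp e X]
    · rw [← hg, map_shiftSum, ← shiftSum_comp_perm u κ b c hf]
      congr 1
      funext i
      simp
  · rcases eq_or_ne g 0 with rfl | hg0
    · simp
    have degree_le := totalDegree_shiftSum_le u κ b c f
    have degree_prod_X : (∏ i, X i : MvPolynomial (Fin n) F).totalDegree = n := by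
      rw [totalDegree_prod_eq_card _ _ fun i _ => by simp, Finset.card_univ, Fintype.card_fin]
    rw [hg, totalDegree_mul_of_isDomain (mul_ne_zero prod_X_ne_zero det_ne_zero) hg0,
      totalDegree_mul_of_isDomain prod_X_ne_zero det_ne_zero, degree_prod_X] at degree_le
    lia

end ShiftSumQuotient

section LastVariable

variable {R : Type*} [CommRing R] {n : ℕ}

/-- The substitution of the constant `c` for the last variable. -/
noncomputable def evalLast (c : R) : MvPolynomial (Fin (n + 1)) R →ₐ[R] MvPolynomial (Fin n) R :=
  aeval (Fin.snoc (α := fun _ => MvPolynomial (Fin n) R) X (C c))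

theorem totalDegree_evalLast_le [Nontrivial R] (c : R) (f : MvPolynomial (Fin (n + 1)) R) :
    (evalLast c f).totalDegree ≤ f.totalDegree := by
  refine totalDegree_aeval_le _ (fun i => ?_) f
  induction i using Fin.lastCases <;> simp

theorem isSymmetric_evalLast (c : R) {f : MvPolynomial (Fin (n + 1)) R} (hf : f.IsSymmetric) :
    (evalLast c f).IsSymmetric := by
  intro e
  let extend_e : Equiv.Perm (Fin (n + 1)) :=
    finSuccEquivLast.symm.permCongr (Equiv.optionCongr e)
  have rename_comp : (rename e).comp (evalLast c) = (evalLast c).comp (rename extend_e) := by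
    refine algHom_ext fun i => ?_
    induction i using Fin.lastCases <;> simp [evalLast, extend_e, Equiv.permCongr_apply]
  simpa only [AlgHom.comp_apply, hf extend_e] using DFunLike.congr_fun rename_comp f

theorem eval_evalLast (c : R) (f : MvPolynomial (Fin (n + 1)) R) (v : Fin n → R) :
    eval v (evalLast c f) = eval (Fin.snoc (α := fun _ => R) v c) f := by
  rw [← coe_aeval_eq_eval, ← coe_aeval_eq_eval, RingHom.coe_coe, RingHom.coe_coe, evalLast,
    ← AlgHom.comp_apply, comp_aeval]
  congr 2
  funext i
  induction i using Fin.lastCases <;> simp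

theorem evalLast_monomial (c : R) (s : Fin (n + 1) →₀ ℕ) (r : R) :
    evalLast c (monomial s r) =
      monomial (Finsupp.equivFunOnFinite.symm (s ∘ Fin.castSucc)) (r * c ^ s (Fin.last n)) := by
  rw [evalLast, aeval_monomial, algebraMap_eq, Finsupp.prod_fintype _ _ (by simp),
    Fin.prod_univ_castSucc, monomial_eq, Finsupp.prod_fintype _ _ (by simp)]
  simp only [Fin.snoc_castSucc, Fin.snoc_last, map_mul, map_pow,
    Finsupp.equivFunOnFinite_symm_apply_apply, Function.comp_apply]
  ring

theorem coeff_evalLast (c : R) {f : MvPolynomial (Fin (n + 1)) R} (m : Fin (n + 1) →₀ ℕ)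
    (hm : m (Fin.last n) = 0) (hd : f.totalDegree ≤ m.degree) :
    coeff (Finsupp.equivFunOnFinite.symm (m ∘ Fin.castSucc)) (evalLast c f) = coeff m f := by
  have eq_of_comp_castSucc_eq : ∀ s ∈ f.support,
      Finsupp.equivFunOnFinite.symm (s ∘ Fin.castSucc) =
        Finsupp.equivFunOnFinite.symm (m ∘ Fin.castSucc) → s = m := by
    intro s hs h
    have apply_castSucc_eq : ∀ i : Fin n, s i.castSucc = m i.castSucc := fun i => by
      simpa using DFunLike.congr_fun h i
    have degree_le : s.degree ≤ m.degree := (le_totalDegree hs).trans hd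
    simp only [Finsupp.degree_eq_sum, Fin.sum_univ_castSucc, apply_castSucc_eq, hm] at degree_le
    ext i
    induction i using Fin.lastCases with
    | last => lia
    | cast i => exact apply_castSucc_eq i
  conv_lhs => rw [f.as_sum, map_sum, coeff_sum]
  rw [Finset.sum_eq_single m]
  · rw [evalLast_monomial, coeff_monomial, if_pos rfl, hm, pow_zero, mul_one]
  · intro s hs hne
    rw [evalLast_monomial, coeff_monomial, if_neg fun h => hne (eq_of_comp_castSucc_eq s hs h)]
  · intro hm_support
    rw [notMem_support_iff.1 hm_support, monomial_zero, map_zero, coeff_zero]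

theorem aeval_update_eq_zero_of_evalLast_eq_zero {c : R} {f : MvPolynomial (Fin (n + 1)) R}
    (hf : f.IsSymmetric) (h : evalLast c f = 0) (i : Fin (n + 1)) :
    aeval (Function.update X i (C c : MvPolynomial (Fin (n + 1)) R)) f = 0 := by
  have update_last : aeval (Function.update X (Fin.last n) (C c)) =
      (rename Fin.castSucc).comp (evalLast c) := by
    refine algHom_ext fun j => ?_
    induction j using Fin.lastCases <;> simp [evalLast]
  have update_i : aeval (Function.update X i (C c)) =
      (rename (Equiv.swap i (Fin.last n))).comp ((aeval (Function.update X (Fin.last n) (C c))).comp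
        (rename (Equiv.swap i (Fin.last n)) :
          MvPolynomial (Fin (n + 1)) R →ₐ[R] MvPolynomial (Fin (n + 1)) R)) := by
    refine algHom_ext fun j => ?_
    rcases eq_or_ne j i with rfl | hj
    · simp
    · have swap_ne : Equiv.swap i (Fin.last n) j ≠ Fin.last n := fun h => hj (by
        rwa [Equiv.swap_apply_eq_iff, Equiv.swap_apply_right] at h)
      simp [Function.update_of_ne hj, Function.update_of_ne swap_ne]
  rw [update_i, AlgHom.comp_apply, AlgHom.comp_apply, hf, update_last, AlgHom.comp_apply, h,
    map_zero, map_zero]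

theorem coeff_X_sub_C_mul {σ : Type*} (c : R) (i : σ) {g : MvPolynomial σ R} {m : σ →₀ ℕ}
    (hg : g.totalDegree ≤ m.degree) :
    coeff (Finsupp.single i 1 + m) ((X i - C c) * g) = coeff m g := by
  rw [sub_mul, coeff_sub, coeff_X_mul, coeff_C_mul, sub_eq_self]
  refine mul_eq_zero_of_right _ (coeff_eq_zero_of_totalDegree_lt ?_)
  change g.totalDegree < (Finsupp.single i 1 + m).degree
  rw [map_add, Finsupp.degree_single]
  lia

theorem coeff_prod_X_sub_C_mul [IsDomain R] {σ : Type*} (c : R) {g : MvPolynomial σ R}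
    {m : σ →₀ ℕ} (hg : g.totalDegree ≤ m.degree) (s : Finset σ) :
    coeff (∑ i ∈ s, Finsupp.single i 1 + m) ((∏ i ∈ s, (X i - C c)) * g) = coeff m g := by
  classical
  induction s using Finset.induction_on with
  | empty => simp
  | insert i s hi ih =>
    rw [Finset.prod_insert hi, Finset.sum_insert hi, mul_assoc, add_assoc, coeff_X_sub_C_mul, ih]
    refine (totalDegree_mul _ _).trans ?_
    rw [map_add, map_sum, totalDegree_prod_eq_card s _ fun i _ => totalDegree_X_sub_C i c]
    simpa using hg

end LastVariable

section SpectralPoints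

variable {F : Type*} [Field F] {q t : F} {n : ℕ}

/-- The condition on the parameters under which the theory of interpolation polynomials works:
they are nonzero and satisfy no monomial relation with natural exponents. -/
structure IsGeneric (q t : F) : Prop where
  q_ne_zero : q ≠ 0
  t_ne_zero : t ≠ 0
  eq_zero_of_pow_mul_pow_eq_one : ∀ k l : ℕ, q ^ k * t ^ l = 1 → k = 0 ∧ l = 0

theorem IsGeneric.eq_of_zpow_mul_zpow_eq (hqt : IsGeneric q t) {k k' l l' : ℤ} (hk : k' ≤ k)
    (hl : l' ≤ l) (h : q ^ k * t ^ l = q ^ k' * t ^ l') : k = k' ∧ l = l' := by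
  obtain ⟨k₀, rfl⟩ := Int.le.dest hk
  obtain ⟨l₀, rfl⟩ := Int.le.dest hl
  rw [zpow_add₀ hqt.q_ne_zero, zpow_add₀ hqt.t_ne_zero, zpow_natCast, zpow_natCast] at h
  have pow_mul_pow_eq_one : q ^ k₀ * t ^ l₀ = 1 := by
    refine mul_left_cancel₀ (mul_ne_zero (zpow_ne_zero k' hqt.q_ne_zero)
      (zpow_ne_zero l' hqt.t_ne_zero)) ?_
    linear_combination h
  have := hqt.eq_zero_of_pow_mul_pow_eq_one _ _ pow_mul_pow_eq_one
  lia

theorem IsGeneric.pow_injective (hqt : IsGeneric q t) :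
    Function.Injective fun N : ℕ => q ^ N := by
  refine Function.Injective.of_lt_imp_ne fun k l hkl h => ?_
  have := (hqt.eq_of_zpow_mul_zpow_eq (Int.ofNat_le.2 hkl.le) le_rfl (l := 0)
    (by simpa using h.symm)).1
  lia

/-- The point with coordinates `q ^ wᵢ * τᵢ`. -/
def spectralPoint (q t : F) (w : Fin n → ℤ) (i : Fin n) : F :=
  q ^ w i * t ^ (-(i : ℤ))

theorem spectralPoint_ne_zero (hqt : IsGeneric q t) (w : Fin n → ℤ) (i : Fin n) :
    spectralPoint q t w i ≠ 0 :=
  mul_ne_zero (zpow_ne_zero _ hqt.q_ne_zero) (zpow_ne_zero _ hqt.t_ne_zero)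

theorem spectralPoint_injective (hqt : IsGeneric q t) {w : Fin n → ℤ} (hw : Antitone w) :
    Function.Injective (spectralPoint q t w) := by
  refine Function.Injective.of_lt_imp_ne fun i j hij h => ?_
  have := (hqt.eq_of_zpow_mul_zpow_eq (hw hij.le) (by simpa using hij.le) h).2
  exact hij.ne (Fin.ext (by lia))

theorem spectralPoint_add_const (hq : q ≠ 0) (w : Fin n → ℤ) (k : ℤ) :
    spectralPoint q t (fun i => w i + k) = q ^ k • spectralPoint q t w := by
  funext i
  rw [spectralPoint, zpow_add₀ hq, Pi.smul_apply, spectralPoint, smul_eq_mul]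
  ring

end SpectralPoints

namespace Partitions

variable {n : ℕ}

/-- The exponent vector of the monomial `x^μ`. -/
noncomputable def exponent (mu : Partitions n) : Fin n →₀ ℕ :=
  Finsupp.equivFunOnFinite.symm mu.1

/-- The parts of `μ` as the exponents of `q` in a spectral point. -/
def weight (mu : Partitions n) (i : Fin n) : ℤ := mu.1 i

/-- The rectangular partition `(Nⁿ)`. -/
def rect (n N : ℕ) : Partitions n :=
  ⟨fun _ => N, antitone_const⟩

/-- The partition obtained by appending a zero part. -/
def snocZero (mu : Partitions n) : Partitions (n + 1) :=
  ⟨Fin.snoc mu.1 0, by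
    intro i j hij
    induction j using Fin.lastCases with
    | last => simp
    | cast j =>
      induction i using Fin.lastCases with
      | last => exact absurd hij (not_le.2 (Fin.castSucc_lt_last j))
      | cast i => simpa using mu.2 (by simpa using hij)⟩

/-- The partition obtained by adding one to all parts. -/
def succ (mu : Partitions n) : Partitions n :=
  ⟨fun i => mu.1 i + 1, fun _ _ h => Nat.add_le_add_right (mu.2 h) 1⟩

theorem exponent_injective : Function.Injective (exponent (n := n)) :=
  Finsupp.equivFunOnFinite.symm.injective.comp Subtype.val_injective

theorem degree_exponent (mu : Partitions n) : mu.exponent.degree = mu.size :=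
  Finsupp.degree_eq_sum _

theorem antitone_weight (mu : Partitions n) : Antitone mu.weight :=
  fun _ _ h => Int.ofNat_le.2 (mu.2 h)

theorem size_snocZero (mu : Partitions n) : mu.snocZero.size = mu.size := by
  simp [size, snocZero, Fin.sum_univ_castSucc]

theorem size_succ (mu : Partitions n) : mu.succ.size = mu.size + n := by
  simp [size, succ, Finset.sum_add_distrib]

theorem exponent_snocZero_comp_castSucc (mu : Partitions n) :
    Finsupp.equivFunOnFinite.symm (mu.snocZero.exponent ∘ Fin.castSucc) = mu.exponent := by
  ext i
  simp [exponent, snocZero]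

theorem exponent_succ (mu : Partitions n) :
    mu.succ.exponent = ∑ i, Finsupp.single i 1 + mu.exponent := by
  ext i
  simp [succ, exponent, Finsupp.single_apply, add_comm]

theorem finite_size_le (n d : ℕ) : Finite {mu : Partitions n // mu.size ≤ d} := by
  have : Finite {m : Fin n →₀ ℕ | m.degree ≤ d} := Finsupp.finite_of_degree_le d
  exact Finite.of_injective
    (Set.codRestrict (fun mu : {mu : Partitions n // mu.size ≤ d} => mu.1.exponent)
      {m | m.degree ≤ d} fun mu => (degree_exponent _).trans_le mu.2)
    fun mu nu h => Subtype.ext (exponent_injective (congrArg Subtype.val h))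

theorem eq_of_mapDomain_exponent_eq {mu nu : Partitions n} (e : Equiv.Perm (Fin n))
    (h : mu.exponent.mapDomain e = nu.exponent) : mu = nu := by
  have comp_e : nu.1 ∘ e = mu.1 := by
    funext i
    have := DFunLike.congr_fun h (e i)
    rw [Finsupp.mapDomain_apply e.injective] at this
    exact this.symm
  refine Subtype.ext (comp_e.symm.trans ?_)
  exact Tuple.unique_antitone (σ := e) (τ := 1) (comp_e ▸ mu.2) nu.2

end Partitions

section Uniqueness

variable {F : Type*} [Field F] {q t : F} {n : ℕ}

/-- In degrees at most `d`, the polynomial `f` satisfies for every partition `μ` one linear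
condition: it vanishes at `s μ̄`, or `|μ| = d` and its coefficient of `x^μ` vanishes. -/
def VanishesThrough (q t s : F) (d : ℕ) (f : MvPolynomial (Fin n) F) : Prop :=
  ∀ mu : Partitions n, mu.size ≤ d →
    eval (s • spectralPoint q t mu.weight) f = 0 ∨ mu.size = d ∧ coeff mu.exponent f = 0

variable {s : F} {d : ℕ}

theorem VanishesThrough.evalLast {f : MvPolynomial (Fin (n + 1)) F} (hd : f.totalDegree ≤ d)
    (h : VanishesThrough q t s d f) :
    VanishesThrough q t s d (evalLast (s * t ^ (-(n : ℤ))) f) := by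
  intro mu hmu
  refine (h mu.snocZero (by rwa [mu.size_snocZero])).imp (fun h_eval => ?_) fun h_coeff => ?_
  · rw [eval_evalLast, ← h_eval]
    congr 2
    funext i
    induction i using Fin.lastCases <;>
      simp [spectralPoint, Partitions.weight, Partitions.snocZero]
  · rw [mu.size_snocZero] at h_coeff
    refine ⟨h_coeff.1, ?_⟩
    rw [← mu.exponent_snocZero_comp_castSucc, coeff_evalLast _ _ (by simp [Partitions.exponent,
      Partitions.snocZero]) (by rwa [Partitions.degree_exponent, mu.size_snocZero, h_coeff.1]),
      h_coeff.2]

theorem VanishesThrough.of_prod_X_sub_C_mul (hqt : IsGeneric q t) (hs : s ≠ 0)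
    {g : MvPolynomial (Fin (n + 1)) F} (hd : g.totalDegree ≤ d)
    (h : VanishesThrough q t s (d + (n + 1)) ((∏ i, (X i - C (s * t ^ (-(n : ℤ))))) * g)) :
    VanishesThrough q t (s * q) d g := by
  intro mu hmu
  refine (h mu.succ (by rw [mu.size_succ]; lia)).imp (fun h_eval => ?_) fun h_coeff => ?_
  · have weight_succ : mu.succ.weight = fun i => mu.weight i + 1 := by
      funext i
      simp [Partitions.succ, Partitions.weight]
    have factor_ne_zero : ∀ i : Fin (n + 1),
        (s • spectralPoint q t mu.succ.weight) i - s * t ^ (-(n : ℤ)) ≠ 0 := by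
      intro i
      rw [Pi.smul_apply, smul_eq_mul, ← mul_sub]
      refine mul_ne_zero hs (sub_ne_zero.2 fun h_eq => ?_)
      rw [spectralPoint, ← one_mul (t ^ (-(n : ℤ))), ← zpow_zero q] at h_eq
      have := (hqt.eq_of_zpow_mul_zpow_eq (by simp [Partitions.weight])
        (by simpa using i.is_le) h_eq).1
      simp only [Partitions.weight, Partitions.succ] at this
      lia
    rw [map_mul, map_prod] at h_eval
    have eval_eq := (mul_eq_zero.1 h_eval).resolve_left (Finset.prod_ne_zero_iff.2 fun i _ => by
      simpa only [map_sub, eval_X, eval_C] using factor_ne_zero i)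
    rwa [weight_succ, spectralPoint_add_const hqt.q_ne_zero, zpow_one, smul_smul] at eval_eq
  · rw [mu.size_succ, mu.exponent_succ, coeff_prod_X_sub_C_mul] at h_coeff
    · exact ⟨by lia, h_coeff.2⟩
    · rw [mu.degree_exponent]
      lia

theorem VanishesThrough.eq_zero (hqt : IsGeneric q t) (hs : s ≠ 0) {f : MvPolynomial (Fin n) F}
    (hf : f.IsSymmetric) (hd : f.totalDegree ≤ d) (h : VanishesThrough q t s d f) : f = 0 := by
  induction n generalizing d s with
  | zero =>
    obtain ⟨r, rfl⟩ := C_surjective (Fin 0) f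
    rcases h (Partitions.rect 0 0) (by simp [Partitions.size]) with h_eval | h_coeff
    · rw [eval_C] at h_eval
      rw [h_eval, map_zero]
    · rw [Subsingleton.elim (Partitions.exponent _) (0 : Fin 0 →₀ ℕ), coeff_zero_C] at h_coeff
      rw [h_coeff.2, map_zero]
  | succ n ih_vars =>
    induction d using Nat.strong_induction_on generalizing s f with
    | h d ih_degree =>
      by_contra hne
      have evalLast_eq_zero := ih_vars hs (isSymmetric_evalLast _ hf)
        ((totalDegree_evalLast_le _ f).trans hd) (h.evalLast hd)
      obtain ⟨g, rfl⟩ :=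
        prod_X_sub_C_dvd _ (aeval_update_eq_zero_of_evalLast_eq_zero hf evalLast_eq_zero)
      have prod_ne_zero := left_ne_zero_of_mul hne
      have g_ne_zero := right_ne_zero_of_mul hne
      rw [totalDegree_mul_of_isDomain prod_ne_zero g_ne_zero,
        totalDegree_prod_eq_card _ _ fun i _ => totalDegree_X_sub_C i _, Finset.card_univ,
        Fintype.card_fin] at hd
      obtain ⟨d, rfl⟩ := Nat.exists_eq_add_of_le' (Nat.le_of_add_right_le hd)
      refine g_ne_zero (ih_degree d (by lia) (mul_ne_zero hs hqt.q_ne_zero) (fun e => ?_)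
        (by lia) (h.of_prod_X_sub_C_mul hqt hs (by lia)))
      refine rename_eq_of_mul_left prod_ne_zero (ε := 1) ?_ (by rw [hf e, one_smul])
      simp only [map_prod, map_sub, rename_X, rename_C, one_smul]
      exact Equiv.prod_comp e fun i => (X i - C _ : MvPolynomial (Fin (n + 1)) F)

end Uniqueness

section OrbitSums

variable {R : Type*} [CommRing R] {n : ℕ}

variable (R) in
/-- The monomial symmetric polynomial `m_μ`: each monomial in the orbit of `x^μ` occurs in it with
coefficient one. -/
noncomputable def orbitSum (mu : Partitions n) : MvPolynomial (Fin n) R :=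
  ∑ m ∈ Finset.univ.image fun e : Equiv.Perm (Fin n) => mu.exponent.mapDomain e, monomial m 1

theorem isSymmetric_orbitSum (mu : Partitions n) : (orbitSum R mu).IsSymmetric := by
  intro e
  have mapDomain_comp_orbit : (Finsupp.mapDomain e ∘ fun e' : Equiv.Perm (Fin n) =>
      mu.exponent.mapDomain e') = (fun e' : Equiv.Perm (Fin n) =>
        mu.exponent.mapDomain e') ∘ Equiv.mulLeft e :=
    _root_.funext fun e' => Finsupp.mapDomain_comp.symm
  simp only [orbitSum, map_sum, rename_monomial]
  rw [← Finset.sum_image (f := fun m => monomial m (1 : R))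
    (Finsupp.mapDomain_injective e.injective).injOn, Finset.image_image, mapDomain_comp_orbit,
    ← Finset.image_image, Finset.image_univ_equiv]

theorem totalDegree_orbitSum_le (mu : Partitions n) :
    (orbitSum R mu).totalDegree ≤ mu.size := by
  refine totalDegree_finsetSum_le fun m hm => (totalDegree_monomial_le _ _).trans ?_
  obtain ⟨e, -, rfl⟩ := Finset.mem_image.1 hm
  change (mu.exponent.mapDomain e).degree ≤ mu.size
  rw [Finsupp.degree_mapDomain, mu.degree_exponent]

theorem coeff_orbitSum_of_ne {mu nu : Partitions n} (h : mu ≠ nu) :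
    coeff nu.exponent (orbitSum R mu) = 0 := by
  rw [orbitSum, coeff_sum]
  refine Finset.sum_eq_zero fun m hm => ?_
  obtain ⟨e, -, rfl⟩ := Finset.mem_image.1 hm
  rw [coeff_monomial, if_neg fun h_eq => h (Partitions.eq_of_mapDomain_exponent_eq e h_eq)]

theorem coeff_orbitSum_self (mu : Partitions n) : coeff mu.exponent (orbitSum R mu) = 1 := by
  have exponent_mem : mu.exponent ∈
      Finset.univ.image fun e : Equiv.Perm (Fin n) => mu.exponent.mapDomain e :=
    Finset.mem_image.2 ⟨1, Finset.mem_univ _, Finsupp.mapDomain_id⟩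
  simp [orbitSum, coeff_sum, coeff_monomial, exponent_mem]

variable (R) in
/-- The linear combinations of the monomial symmetric polynomials of degree at most `d`. -/
noncomputable def orbitCombination (n d : ℕ) :
    ({mu : Partitions n // mu.size ≤ d} →₀ R) →ₗ[R] MvPolynomial (Fin n) R :=
  Finsupp.linearCombination R fun mu => orbitSum R mu.1

variable {d : ℕ} (c : {mu : Partitions n // mu.size ≤ d} →₀ R)

theorem isSymmetric_orbitCombination : (orbitCombination R n d c).IsSymmetric := by
  rw [orbitCombination, Finsupp.linearCombination_apply, ← mem_symmetricSubalgebra]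
  exact sum_mem fun mu _ => Subalgebra.smul_mem _ (isSymmetric_orbitSum mu.1) _

theorem totalDegree_orbitCombination_le : (orbitCombination R n d c).totalDegree ≤ d := by
  rw [orbitCombination, Finsupp.linearCombination_apply]
  exact totalDegree_finsetSum_le fun mu _ => (totalDegree_smul_le _ _).trans
    ((totalDegree_orbitSum_le _).trans mu.2)

theorem coeff_orbitCombination (mu : {mu : Partitions n // mu.size ≤ d}) :
    coeff mu.1.exponent (orbitCombination R n d c) = c mu := by
  rw [orbitCombination, Finsupp.linearCombination_apply, Finsupp.sum, coeff_sum,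
    Finset.sum_eq_single mu]
  · rw [coeff_smul, coeff_orbitSum_self, smul_eq_mul, mul_one]
  · intro nu _ hne
    rw [coeff_smul, coeff_orbitSum_of_ne fun h => hne (Subtype.ext h), smul_zero]
  · intro hmu
    rw [Finsupp.notMem_support_iff.1 hmu, zero_smul, coeff_zero]

end OrbitSums

section Interpolation

variable {F : Type*} [Field F] {q t : F} {n : ℕ}

/-- The conditions defining the symmetric interpolation Macdonald polynomial `R_λ(x; q, t)` for
parameters `q` and `t` in an arbitrary field. -/
structure IsInterpolation (q t : F) (lam : Partitions n) (R : MvPolynomial (Fin n) F) : Prop where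
  isSymmetric : R.IsSymmetric
  totalDegree_le : R.totalDegree ≤ lam.size
  eval_eq_zero : ∀ mu : Partitions n, mu.size ≤ lam.size → mu ≠ lam →
    eval (spectralPoint q t mu.weight) R = 0
  coeff_eq_one : coeff lam.exponent R = 1

variable {lam : Partitions n} {R : MvPolynomial (Fin n) F}

theorem IsInterpolation.eval_self_ne_zero (hqt : IsGeneric q t) (hR : IsInterpolation q t lam R) :
    eval (spectralPoint q t lam.weight) R ≠ 0 := by
  intro h
  have vanishes : VanishesThrough q t 1 lam.size R := by
    intro mu hmu
    rw [one_smul]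
    by_cases hne : mu = lam
    · exact Or.inl (hne ▸ h)
    · exact Or.inl (hR.eval_eq_zero mu hmu hne)
  have coeff_eq := hR.coeff_eq_one
  rw [vanishes.eq_zero hqt one_ne_zero hR.isSymmetric hR.totalDegree_le, coeff_zero] at coeff_eq
  exact zero_ne_one coeff_eq

theorem IsInterpolation.eq_smul (hqt : IsGeneric q t) (hR : IsInterpolation q t lam R)
    {f : MvPolynomial (Fin n) F} (hf : f.IsSymmetric) (hd : f.totalDegree ≤ lam.size)
    (h : ∀ mu : Partitions n, mu.size ≤ lam.size → mu ≠ lam →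
      eval (spectralPoint q t mu.weight) f = 0) :
    f = (eval (spectralPoint q t lam.weight) f / eval (spectralPoint q t lam.weight) R) • R := by
  have vanishes : VanishesThrough q t 1 lam.size
      (f - (eval (spectralPoint q t lam.weight) f /
        eval (spectralPoint q t lam.weight) R) • R) := by
    intro mu hmu
    rw [one_smul, map_sub, smul_eval]
    refine Or.inl ?_
    by_cases hne : mu = lam
    · rw [hne, div_mul_cancel₀ _ (hR.eval_self_ne_zero hqt), sub_self]
    · rw [h mu hmu hne, hR.eval_eq_zero mu hmu hne, mul_zero, sub_self]
  exact sub_eq_zero.1 (vanishes.eq_zero hqt one_ne_zero (hf.sub (hR.isSymmetric.smul _))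
    ((totalDegree_sub _ _).trans (max_le hd ((totalDegree_smul_le _ _).trans hR.totalDegree_le))))

theorem IsInterpolation.eq (hqt : IsGeneric q t) {R' : MvPolynomial (Fin n) F}
    (hR : IsInterpolation q t lam R) (hR' : IsInterpolation q t lam R') : R = R' := by
  have smul_eq := hR'.eq_smul hqt hR.isSymmetric hR.totalDegree_le hR.eval_eq_zero
  have coeff_eq := congrArg (coeff lam.exponent) smul_eq
  rw [coeff_smul, hR.coeff_eq_one, hR'.coeff_eq_one, smul_eq_mul, mul_one] at coeff_eq
  rwa [← coeff_eq, one_smul] at smul_eq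

theorem exists_isInterpolation (hqt : IsGeneric q t) (lam : Partitions n) :
    ∃ R, IsInterpolation q t lam R := by
  classical
  have := Partitions.finite_size_le n lam.size
  let S := orbitCombination F n lam.size
  let data : ({mu : Partitions n // mu.size ≤ lam.size} →₀ F) →ₗ[F]
      {mu : Partitions n // mu.size ≤ lam.size} → F := LinearMap.pi fun mu =>
    if mu.1 = lam then lcoeff F lam.exponent ∘ₗ S
    else (aeval (spectralPoint q t mu.1.weight)).toLinearMap ∘ₗ S
  have data_injective : Function.Injective data := by
    refine (injective_iff_map_eq_zero data).2 fun c hc => ?_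
    have vanishes : VanishesThrough q t 1 lam.size (S c) := by
      intro mu hmu
      have data_eq_zero := congrFun hc ⟨mu, hmu⟩
      rw [one_smul]
      by_cases h : mu = lam
      · subst h
        exact Or.inr ⟨rfl, by simpa [data] using data_eq_zero⟩
      · exact Or.inl (by simpa [data, h, aeval_eq_eval] using data_eq_zero)
    ext mu
    rw [← coeff_orbitCombination c, vanishes.eq_zero hqt one_ne_zero
      (isSymmetric_orbitCombination c) (totalDegree_orbitCombination_le c), coeff_zero,
      Finsupp.zero_apply]
  obtain ⟨c, hc⟩ := (LinearMap.injective_iff_surjective_of_finrank_eq_finrank (by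
    rw [(Finsupp.linearEquivFunOnFinite F F _).finrank_eq])).1 data_injective
      (Pi.single ⟨lam, le_rfl⟩ 1)
  refine ⟨S c, isSymmetric_orbitCombination c, totalDegree_orbitCombination_le c,
    fun mu hmu hne => ?_, ?_⟩
  · simpa [data, hne, aeval_eq_eval] using congrFun hc ⟨mu, hmu⟩
  · simpa [data] using congrFun hc ⟨lam, le_rfl⟩

end Interpolation

namespace Partitions

variable {n : ℕ}

/-- `σ/ν` is a vertical strip: `σ` arises from `ν` by adding one box to each row in `I`. -/
def IsVerticalStrip (nu sigma : Partitions n) (I : Finset (Fin n)) : Prop :=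
  ∀ i, sigma.1 i = nu.1 i + if i ∈ I then 1 else 0

variable {nu sigma : Partitions n} {I : Finset (Fin n)}

theorem IsVerticalStrip.size_eq (h : nu.IsVerticalStrip sigma I) :
    sigma.size = nu.size + I.card := by
  simp [size, h _, Finset.sum_add_distrib]

theorem IsVerticalStrip.eq_of_empty (h : nu.IsVerticalStrip sigma ∅) : sigma = nu :=
  Subtype.ext (funext fun i => by simpa using h i)

theorem exists_isVerticalStrip (sigma : Partitions (n + 1)) (I : Finset (Fin (n + 1)))
    (h_last : Fin.last n ∈ I → sigma.1 (Fin.last n) ≠ 0)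
    (h_step : ∀ i : Fin n, i.castSucc ∈ I → i.succ ∉ I → sigma.1 i.castSucc ≠ sigma.1 i.succ) :
    ∃ nu : Partitions (n + 1), nu.IsVerticalStrip sigma I := by
  have antitone_sub : Antitone fun i => (sigma.1 i : ℤ) - if i ∈ I then 1 else 0 := by
    refine Fin.antitone_iff_succ_le.2 fun i => ?_
    have := h_step i
    have := sigma.2 i.castSucc_lt_succ.le
    split_ifs <;> grind
  have one_le : ∀ i ∈ I, 1 ≤ sigma.1 i := by
    intro i hi
    have := antitone_sub (Fin.le_last i)
    simp only [if_pos hi] at this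
    split_ifs at this <;> grind
  refine ⟨⟨fun i => sigma.1 i - if i ∈ I then 1 else 0, fun i j hij => ?_⟩, fun i => ?_⟩
  · have := antitone_sub hij
    grind
  · have := one_le i
    grind

end Partitions

section VerticalStrips

variable {F : Type*} [Field F] {q t : F} {n : ℕ}

theorem scaleOn_spectralPoint (hq : q ≠ 0) {nu sigma : Partitions n} {I : Finset (Fin n)}
    (h : nu.IsVerticalStrip sigma I) :
    scaleOn q⁻¹ I (spectralPoint q t sigma.weight) = spectralPoint q t nu.weight := by
  funext i
  rw [scaleOn, spectralPoint, spectralPoint, Partitions.weight, Partitions.weight, h i]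
  split_ifs
  · rw [Nat.cast_add, Nat.cast_one, zpow_add_one₀ hq, smul_eq_mul]
    field_simp
  · simp

theorem shiftCoeff_spectralPoint_of_last_eq_zero (ht : t ≠ 0) (b : F) {w : Fin (n + 1) → ℤ}
    {I : Finset (Fin (n + 1))} (hI : Fin.last n ∈ I) (hw : w (Fin.last n) = 0) :
    shiftCoeff (t ^ n) b (spectralPoint q t w) I = 0 := by
  rw [shiftCoeff, Finset.prod_eq_zero hI, zero_mul]
  simp [spectralPoint, hw, ht]

theorem shiftCoeff_spectralPoint_of_eq (ht : t ≠ 0) (κ : F) {w : Fin n → ℤ} {I : Finset (Fin n)}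
    {i j : Fin n} (hij : (j : ℕ) = i + 1) (hi : i ∈ I) (hj : j ∉ I) (hw : w i = w j) :
    shiftCoeff κ t⁻¹ (spectralPoint q t w) I = 0 := by
  rw [shiftCoeff, Matrix.det_vandermonde_eq_zero_iff.2 ⟨i, j, ?_, by grind⟩, mul_zero]
  rw [scaleOn, scaleOn, if_pos hi, if_neg hj, one_smul, spectralPoint, spectralPoint, hw, hij,
    Nat.cast_add, Nat.cast_one, neg_add, zpow_add₀ ht, zpow_neg_one, smul_eq_mul]
  ring

theorem exists_isVerticalStrip_or_shiftCoeff_eq_zero (ht : t ≠ 0) (sigma : Partitions n)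
    (I : Finset (Fin n)) :
    (∃ nu : Partitions n, nu.IsVerticalStrip sigma I) ∨
      shiftCoeff (t ^ (n - 1)) t⁻¹ (spectralPoint q t sigma.weight) I = 0 := by
  cases n with
  | zero => exact Or.inl ⟨sigma, fun i => i.elim0⟩
  | succ n =>
    refine or_iff_not_imp_right.2 fun h_ne => sigma.exists_isVerticalStrip I
      (fun h_last h_zero => h_ne ?_) fun i hi h_succ h_eq => h_ne ?_
    · exact shiftCoeff_spectralPoint_of_last_eq_zero ht _ h_last
        (by simp [Partitions.weight, h_zero])
    · exact shiftCoeff_spectralPoint_of_eq ht _ (by simp) hi h_succ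
        (by simp [Partitions.weight, h_eq])

end VerticalStrips

section EigenvalueEquation

variable {F : Type*} {n : ℕ}

theorem prod_add_eq_prod_mul_prod_one_add {ι : Type*} [Field F] (s : Finset ι) {v : ι → F}
    (hv : ∀ i ∈ s, v i ≠ 0) (u : F) :
    ∏ i ∈ s, (v i + u) = (∏ i ∈ s, v i) * ∏ i ∈ s, (1 + u * (v i)⁻¹) := by
  rw [← Finset.prod_mul_distrib]
  refine Finset.prod_congr rfl fun i hi => ?_
  have := hv i hi
  field_simp

section CommRing

variable [CommRing F]

theorem scaleOn_empty (c : F) (v : Fin n → F) : scaleOn c ∅ v = v := by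
  funext i
  simp [scaleOn]

theorem shiftTerm_empty (u κ b c : F) (f : MvPolynomial (Fin n) F) (v : Fin n → F) :
    shiftTerm u κ b c f v ∅ =
      (∏ i, (v i + u)) * (Matrix.vandermonde v).det * eval v f := by
  simp [shiftTerm, shiftCoeff, scaleOn_empty, aeval_eq_eval]

theorem shiftSum_eq_mul_eval {u κ b c : F} {f g : MvPolynomial (Fin n) F}
    (h : shiftSum u κ b c f X = (∏ i, X i) * (Matrix.vandermonde X).det * g) (v : Fin n → F) :
    shiftSum u κ b c f v = (∏ i, v i) * (Matrix.vandermonde v).det * eval v g := by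
  have aeval_comp_X : aeval (R := F) v ∘ X = v := _root_.funext (aeval_X v)
  have := congrArg (aeval v) h
  rw [map_shiftSum, map_mul, map_mul, map_det_vandermonde, map_prod, aeval_comp_X] at this
  simpa only [aeval_X, aeval_eq_eval] using this

end CommRing

variable [Field F] {q t : F} {lam : Partitions n} {R : MvPolynomial (Fin n) F}

theorem IsInterpolation.shiftTerm_eq_zero (hqt : IsGeneric q t) (hR : IsInterpolation q t lam R)
    {mu : Partitions n} {I : Finset (Fin n)} (hmu : mu.size ≤ lam.size)
    (hI : mu = lam → I.Nonempty) (u : F) :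
    shiftTerm u (t ^ (n - 1)) t⁻¹ q⁻¹ R (spectralPoint q t mu.weight) I = 0 := by
  rw [shiftTerm]
  rcases exists_isVerticalStrip_or_shiftCoeff_eq_zero hqt.t_ne_zero mu I with ⟨nu, hnu⟩ | h
  · have size_eq := hnu.size_eq
    rw [scaleOn_spectralPoint hqt.q_ne_zero hnu, aeval_eq_eval,
      hR.eval_eq_zero nu (by lia), mul_zero]
    rintro rfl
    obtain rfl := Finset.card_eq_zero.1 (by lia : I.card = 0)
    exact Finset.not_nonempty_empty (hI hnu.eq_of_empty)
  · rw [h, mul_zero, zero_mul]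

/-- On partitions `μ` with `|μ| ≤ |λ|` and `μ ≠ λ` every shifted point is a zero of `R_λ`, so the
difference operator preserves the vanishing conditions; at `λ` only the unshifted term remains, and
it gives the eigenvalue. -/
theorem IsInterpolation.shiftSum_spectralPoint (hqt : IsGeneric q t)
    (hR : IsInterpolation q t lam R) (sigma : Partitions n) (u : F) :
    shiftSum u (t ^ (n - 1)) t⁻¹ q⁻¹ R (spectralPoint q t sigma.weight) =
      (∏ i, spectralPoint q t sigma.weight i) *
        (Matrix.vandermonde (spectralPoint q t sigma.weight)).det *
        ((∏ i, (1 + u * (spectralPoint q t lam.weight i)⁻¹)) *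
          eval (spectralPoint q t sigma.weight) R) := by
  obtain ⟨g, g_symm, g_degree, hg⟩ :=
    exists_isSymmetric_mul_eq_shiftSum u (t ^ (n - 1)) t⁻¹ q⁻¹ hR.isSymmetric
  have eval_g := fun mu : Partitions n => shiftSum_eq_mul_eval hg (spectralPoint q t mu.weight)
  have factor_ne_zero : ∀ mu : Partitions n, (∏ i, spectralPoint q t mu.weight i) *
      (Matrix.vandermonde (spectralPoint q t mu.weight)).det ≠ 0 := fun mu =>
    mul_ne_zero (Finset.prod_ne_zero_iff.2 fun i _ => spectralPoint_ne_zero hqt _ i)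
      (Matrix.det_vandermonde_ne_zero_iff.2 (spectralPoint_injective hqt mu.antitone_weight))
  have g_eq_smul := hR.eq_smul hqt g_symm (g_degree.trans hR.totalDegree_le) fun mu hmu hne => by
    have := eval_g mu
    rw [shiftSum, Finset.sum_eq_zero fun I _ =>
      hR.shiftTerm_eq_zero hqt hmu (fun h => absurd h hne) u] at this
    exact (mul_eq_zero.1 this.symm).resolve_left (factor_ne_zero mu)
  have eval_g_self : eval (spectralPoint q t lam.weight) g =
      (∏ i, (1 + u * (spectralPoint q t lam.weight i)⁻¹)) *
        eval (spectralPoint q t lam.weight) R := by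
    refine mul_left_cancel₀ (factor_ne_zero lam) ((eval_g lam).symm.trans ?_)
    rw [shiftSum, Finset.sum_eq_single ∅ (fun I _ hI => hR.shiftTerm_eq_zero hqt le_rfl
      (fun _ => Finset.nonempty_iff_ne_empty.2 hI) u) (by simp), shiftTerm_empty,
      prod_add_eq_prod_mul_prod_one_add _ fun i _ => spectralPoint_ne_zero hqt _ i]
    ring
  rw [eval_g sigma, g_eq_smul, smul_eval, eval_g_self,
    mul_div_cancel_right₀ _ (hR.eval_self_ne_zero hqt)]

end EigenvalueEquation

section Recurrence

variable {F : Type*} {n : ℕ}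

section CommRing

variable [CommRing F]

theorem coeff_prod_one_add_X_mul (w : Fin n → F) (r : ℕ) :
    (∏ i, (1 + Polynomial.X * Polynomial.C (w i))).coeff r = eval w (esymm (Fin n) F r) := by
  rw [Finset.prod_one_add, Polynomial.finsetSum_coeff, esymm, map_sum,
    Finset.powersetCard_eq_filter, Finset.sum_filter]
  refine Finset.sum_congr rfl fun s _ => ?_
  rw [Finset.prod_mul_distrib, Finset.prod_const, ← map_prod, Polynomial.coeff_X_pow_mul',
    Polynomial.coeff_C, map_prod]
  simp only [eval_X]
  split_ifs <;> first | rfl | lia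

/-- The factor of `shiftTerm` that depends on its parameter `u`, as a polynomial in `u`. -/
noncomputable def shiftPoly (v : Fin n → F) (I : Finset (Fin n)) : Polynomial F :=
  Polynomial.X ^ I.card * ∏ i ∈ Iᶜ, (Polynomial.X + Polynomial.C (v i))

theorem shiftTerm_eq_eval_shiftPoly (u κ b c : F) (f : MvPolynomial (Fin n) F) (v : Fin n → F)
    (I : Finset (Fin n)) :
    shiftTerm u κ b c f v I =
      (shiftPoly v I).eval u * (shiftCoeff κ b v I * eval (scaleOn c I v) f) := by
  simp [shiftTerm, shiftPoly, Polynomial.eval_prod, aeval_eq_eval, add_comm, mul_assoc]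

theorem coeff_shiftPoly_of_lt (v : Fin n → F) {I : Finset (Fin n)} {r : ℕ} (h : r < I.card) :
    (shiftPoly v I).coeff r = 0 := by
  rw [shiftPoly, Polynomial.coeff_X_pow_mul', if_neg (not_le.2 h)]

theorem coeff_shiftPoly_card (v : Fin n → F) (I : Finset (Fin n)) :
    (shiftPoly v I).coeff I.card = ∏ i ∈ Iᶜ, v i := by
  rw [shiftPoly, Polynomial.coeff_X_pow_mul', if_pos le_rfl, Nat.sub_self,
    Polynomial.coeff_zero_eq_eval_zero, Polynomial.eval_prod]
  simp only [Polynomial.eval_add, Polynomial.eval_X, Polynomial.eval_C, zero_add]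

end CommRing

variable [Field F] {q t : F} {lam : Partitions n} {R : MvPolynomial (Fin n) F}

theorem IsInterpolation.esymm_mul_eval_spectralPoint (hqt : IsGeneric q t)
    (hR : IsInterpolation q t lam R) (sigma : Partitions n) (r : ℕ) :
    (∏ i, spectralPoint q t sigma.weight i) *
        (Matrix.vandermonde (spectralPoint q t sigma.weight)).det *
        (eval (spectralPoint q t lam.weight)⁻¹ (esymm (Fin n) F r) *
          eval (spectralPoint q t sigma.weight) R) =
      ∑ I, (shiftPoly (spectralPoint q t sigma.weight) I).coeff r *
        (shiftCoeff (t ^ (n - 1)) t⁻¹ (spectralPoint q t sigma.weight) I *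
          eval (scaleOn q⁻¹ I (spectralPoint q t sigma.weight)) R) := by
  have := Infinite.of_injective _ hqt.pow_injective
  have polynomial_eq : Polynomial.C ((∏ i, spectralPoint q t sigma.weight i) *
        (Matrix.vandermonde (spectralPoint q t sigma.weight)).det *
        eval (spectralPoint q t sigma.weight) R) *
        ∏ i, (1 + Polynomial.X * Polynomial.C ((spectralPoint q t lam.weight)⁻¹ i)) =
      ∑ I, shiftPoly (spectralPoint q t sigma.weight) I *
        Polynomial.C (shiftCoeff (t ^ (n - 1)) t⁻¹ (spectralPoint q t sigma.weight) I *
          eval (scaleOn q⁻¹ I (spectralPoint q t sigma.weight)) R) := by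
    refine Polynomial.funext fun u => ?_
    have eigenvalue_eq := hR.shiftSum_spectralPoint hqt sigma u
    simp only [shiftSum, shiftTerm_eq_eval_shiftPoly] at eigenvalue_eq
    simp only [Polynomial.eval_mul, Polynomial.eval_C, Polynomial.eval_prod, Polynomial.eval_add,
      Polynomial.eval_one, Polynomial.eval_X, Polynomial.eval_finsetSum, Pi.inv_apply,
      eigenvalue_eq]
    ring
  have coeff_eq := congrArg (Polynomial.coeff · r) polynomial_eq
  simp only [Polynomial.coeff_C_mul, Polynomial.finsetSum_coeff, Polynomial.coeff_mul_C,
    coeff_prod_one_add_X_mul] at coeff_eq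
  rw [← coeff_eq]
  ring

end Recurrence

theorem sum_lt_sum_of_isUpperSet {ι : Type*} [LinearOrder ι] {w : ι → ℕ} (hw : StrictMono w)
    (hw_pos : ∀ i, 0 < w i) {I J : Finset ι} (hJ : IsUpperSet (J : Set ι))
    (hcard : I.card ≤ J.card) (hne : I ≠ J) : ∑ i ∈ I, w i < ∑ i ∈ J, w i := by
  rw [← Finset.sum_sdiff_lt_sum_sdiff]
  have card_sdiff_le := Finset.card_sdiff_le_card_sdiff_iff.2 hcard
  have sdiff_nonempty : (J \ I).Nonempty :=
    Finset.sdiff_nonempty.2 fun hJI => hne (Finset.eq_of_subset_of_card_le hJI hcard).symm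
  obtain ⟨j, hj, hj_min⟩ := (J \ I).exists_min_image w sdiff_nonempty
  calc ∑ i ∈ I \ J, w i ≤ (I \ J).card • (w j - 1) := by
        refine Finset.sum_le_card_nsmul _ _ _ fun i hi => Nat.le_sub_one_of_lt (hw ?_)
        by_contra hji
        exact (Finset.mem_sdiff.1 hi).2 (hJ (not_lt.1 hji) (Finset.mem_sdiff.1 hj).1)
    _ ≤ (J \ I).card • (w j - 1) := Nat.mul_le_mul_right _ card_sdiff_le
    _ < (J \ I).card • w j :=
        Nat.mul_lt_mul_of_pos_left (Nat.sub_one_lt (hw_pos j).ne') sdiff_nonempty.card_pos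
    _ ≤ ∑ i ∈ J \ I, w i := Finset.card_nsmul_le_sum _ _ _ hj_min

namespace Partitions

variable {n N : ℕ} {mu nu sigma : Partitions n} {I : Finset (Fin n)}

/-- A statistic of the complement of `μ` in the rectangle `(Nⁿ)` that weights the boxes by their
row. It is the induction measure in the construction of the dual polynomials. -/
def coweight (N : ℕ) (mu : Partitions n) : ℕ :=
  ∑ i : Fin n, ((i : ℕ) + 1) * (N - mu.1 i)

theorem IsVerticalStrip.coweight_eq (h : nu.IsVerticalStrip sigma I) (hN : ∀ i, sigma.1 i ≤ N) :
    nu.coweight N = sigma.coweight N + ∑ i ∈ I, ((i : ℕ) + 1) := by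
  rw [coweight, coweight, ← Finset.univ_inter I, ← Finset.filter_mem_eq_inter, Finset.sum_filter,
    ← Finset.sum_add_distrib]
  refine Finset.sum_congr rfl fun i _ => ?_
  have h_part := h i
  have h_le := hN i
  split_ifs at h_part ⊢
  · rw [← Nat.mul_succ]
    congr 1
    lia
  · rw [h_part, add_zero, add_zero]

/-- The rows of `μ` that are shorter than `N`. -/
def shortRows (N : ℕ) (mu : Partitions n) : Finset (Fin n) :=
  {i | mu.1 i < N}

/-- The partition obtained from `μ` by adding one box to each row that is shorter than `N`. -/
def grow (N : ℕ) (mu : Partitions n) : Partitions n :=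
  ⟨fun i => min (mu.1 i + 1) N, fun _ _ h => min_le_min_right N (Nat.succ_le_succ (mu.2 h))⟩

theorem isVerticalStrip_grow (h : ∀ i, mu.1 i ≤ N) :
    mu.IsVerticalStrip (mu.grow N) (mu.shortRows N) := by
  intro i
  have := h i
  simp only [grow, shortRows, Finset.mem_filter_univ]
  split_ifs <;> lia

theorem isUpperSet_shortRows (N : ℕ) (mu : Partitions n) :
    IsUpperSet (mu.shortRows N : Set (Fin n)) := by
  intro i j hij hi
  simp only [shortRows, Finset.coe_filter_univ, Set.mem_ofPred_eq] at hi ⊢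
  exact (mu.2 hij).trans_lt hi

theorem size_rect (n N : ℕ) : (rect n N).size = n * N := by
  simp [size, rect]

theorem size_le_of_forall_le (h : ∀ i, mu.1 i ≤ N) : mu.size ≤ n * N :=
  (Finset.sum_le_sum fun i _ => h i).trans_eq (size_rect n N)

end Partitions

section DualSpace

theorem totalDegree_esymm_le (σ F : Type*) [Fintype σ] [CommSemiring F] [Nontrivial F] (r : ℕ) :
    (esymm σ F r).totalDegree ≤ r := by
  refine totalDegree_finsetSum_le fun s hs => (totalDegree_finsetProd _ _).trans ?_
  simp [(Finset.mem_powersetCard.1 hs).2]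

variable {F : Type*} [Field F] {n : ℕ}

/-- The functions of `λ` of the form `R_λ(q^N τ) P(λ̄⁻¹)`, where `P` is a symmetric polynomial of
degree at most `d`. -/
noncomputable def dualSpace (q t : F) (R : Partitions n → MvPolynomial (Fin n) F) (N d : ℕ) :
    Submodule F (Partitions n → F) :=
  (Subalgebra.toSubmodule (symmetricSubalgebra (Fin n) F) ⊓ restrictTotalDegree (Fin n) F d).map
    (LinearMap.pi fun lam => eval (spectralPoint q t (Partitions.rect n N).weight) (R lam) •
      (aeval (spectralPoint q t lam.weight)⁻¹).toLinearMap)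

variable {q t : F} {R : Partitions n → MvPolynomial (Fin n) F} {N d : ℕ}

theorem mem_dualSpace {f : Partitions n → F} :
    f ∈ dualSpace q t R N d ↔ ∃ P : MvPolynomial (Fin n) F, P.IsSymmetric ∧ P.totalDegree ≤ d ∧
      ∀ lam, f lam = eval (spectralPoint q t (Partitions.rect n N).weight) (R lam) *
        eval (spectralPoint q t lam.weight)⁻¹ P := by
  simp only [dualSpace, Submodule.mem_map, Submodule.mem_inf, Subalgebra.mem_toSubmodule,
    mem_symmetricSubalgebra, mem_restrictTotalDegree, and_assoc, funext_iff, LinearMap.pi_apply,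
    LinearMap.smul_apply, AlgHom.toLinearMap_apply, aeval_eq_eval, smul_eq_mul, eq_comm]

theorem dualSpace_mono {d' : ℕ} (h : d ≤ d') : dualSpace q t R N d ≤ dualSpace q t R N d' := by
  intro f hf
  obtain ⟨P, P_symm, P_degree, hP⟩ := mem_dualSpace.1 hf
  exact mem_dualSpace.2 ⟨P, P_symm, P_degree.trans h, hP⟩

theorem esymm_mul_mem_dualSpace {f : Partitions n → F} (hf : f ∈ dualSpace q t R N d) (r : ℕ) :
    (fun lam => eval (spectralPoint q t lam.weight)⁻¹ (esymm (Fin n) F r) * f lam) ∈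
      dualSpace q t R N (d + r) := by
  obtain ⟨P, P_symm, P_degree, hP⟩ := mem_dualSpace.1 hf
  refine mem_dualSpace.2 ⟨esymm (Fin n) F r * P, (esymm_isSymmetric _ _ _).mul P_symm, ?_,
    fun lam => ?_⟩
  · have := totalDegree_mul (esymm (Fin n) F r) P
    have := totalDegree_esymm_le (Fin n) F r
    lia
  · rw [hP, map_mul]
    ring

theorem shiftCoeff_spectralPoint_ne_zero (hqt : IsGeneric q t) {w : Fin n → ℤ} (hw : Antitone w)
    {I : Finset (Fin n)} (hI : IsUpperSet (I : Set (Fin n))) (hw_pos : ∀ i ∈ I, 0 < w i) :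
    shiftCoeff (t ^ (n - 1)) t⁻¹ (spectralPoint q t w) I ≠ 0 := by
  refine mul_ne_zero (Finset.prod_ne_zero_iff.2 fun i hi h => ?_)
    (Matrix.det_vandermonde_ne_zero_iff.2 (Function.Injective.of_lt_imp_ne fun i j hij h => ?_))
  · have zpow_eq : q ^ w i * t ^ (((n - 1 : ℕ) : ℤ) + -(i : ℤ)) = q ^ (0 : ℤ) * t ^ (0 : ℤ) := by
      rw [zpow_add₀ hqt.t_ne_zero, zpow_natCast, zpow_zero, zpow_zero]
      rw [spectralPoint, smul_eq_mul] at h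
      linear_combination h
    have := (hqt.eq_of_zpow_mul_zpow_eq (hw_pos i hi).le (by omega) zpow_eq).1
    exact (hw_pos i hi).ne' this
  · have scaleOn_eq : ∀ i, scaleOn t⁻¹ I (spectralPoint q t w) i =
        q ^ w i * t ^ (-(i : ℤ) - if i ∈ I then 1 else 0) := by
      intro i
      rw [scaleOn, spectralPoint]
      split_ifs
      · rw [smul_eq_mul, zpow_sub_one₀ hqt.t_ne_zero]
        ring
      · rw [one_smul, sub_zero]
    have exponent_lt :
        (-(j : ℤ) - if j ∈ I then 1 else 0) < -(i : ℤ) - if i ∈ I then 1 else 0 := by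
      have : i ∈ I → j ∈ I := fun hi => hI hij.le hi
      split_ifs <;> grind
    rw [scaleOn_eq, scaleOn_eq] at h
    exact exponent_lt.ne' (hqt.eq_of_zpow_mul_zpow_eq (hw hij.le) exponent_lt.le h).2

/-- The coefficient of `u ^ |J|` in the eigenvalue equation at `σ` expresses the value at `ρ̄`
through the values at `σ̄` and at the points `ν̄` with `σ/ν` a vertical strip in at most `|J|` rows
other than `J`. -/
theorem eval_mem_dualSpace_of_isVerticalStrip (hqt : IsGeneric q t)
    (hR : ∀ lam, IsInterpolation q t lam (R lam)) {rho sigma : Partitions n} {J : Finset (Fin n)}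
    (hrho : rho.IsVerticalStrip sigma J) (hJ : IsUpperSet (J : Set (Fin n)))
    (hsigma : (fun lam => eval (spectralPoint q t sigma.weight) (R lam)) ∈ dualSpace q t R N d)
    (hnu : ∀ I : Finset (Fin n), I ≠ J → I.card ≤ J.card → ∀ nu : Partitions n,
      nu.IsVerticalStrip sigma I →
      (fun lam => eval (spectralPoint q t nu.weight) (R lam)) ∈ dualSpace q t R N (d + J.card)) :
    (fun lam => eval (spectralPoint q t rho.weight) (R lam)) ∈
      dualSpace q t R N (d + J.card) := by
  set v := spectralPoint q t sigma.weight
  let c (I : Finset (Fin n)) : F :=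
    (shiftPoly v I).coeff J.card * shiftCoeff (t ^ (n - 1)) t⁻¹ v I
  have c_J_ne_zero : c J ≠ 0 := by
    refine mul_ne_zero ?_ (shiftCoeff_spectralPoint_ne_zero hqt sigma.antitone_weight hJ
      fun i hi => by simp [Partitions.weight, hrho i, hi])
    rw [coeff_shiftPoly_card]
    exact Finset.prod_ne_zero_iff.2 fun i _ => spectralPoint_ne_zero hqt _ i
  have term_mem : ∀ I ≠ J,
      (c I • fun lam => eval (scaleOn q⁻¹ I v) (R lam)) ∈ dualSpace q t R N (d + J.card) := by
    intro I hI
    rcases lt_or_ge J.card I.card with hcard | hcard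
    · simp only [c, coeff_shiftPoly_of_lt _ hcard, zero_mul, zero_smul, zero_mem]
    rcases exists_isVerticalStrip_or_shiftCoeff_eq_zero (q := q) hqt.t_ne_zero sigma I with
      ⟨nu, h_strip⟩ | h_zero
    · rw [scaleOn_spectralPoint hqt.q_ne_zero h_strip]
      exact Submodule.smul_mem _ _ (hnu I hI hcard nu h_strip)
    · simp only [c, v, h_zero, mul_zero, zero_smul, zero_mem]
  have recurrence : (c J • fun lam => eval (spectralPoint q t rho.weight) (R lam)) =
      (((∏ i, v i) * (Matrix.vandermonde v).det) •
        fun lam => eval (spectralPoint q t lam.weight)⁻¹ (esymm (Fin n) F J.card) *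
          eval v (R lam)) -
      ∑ I ∈ Finset.univ.erase J, c I • fun lam => eval (scaleOn q⁻¹ I v) (R lam) := by
    funext lam
    have := (hR lam).esymm_mul_eval_spectralPoint hqt sigma J.card
    rw [← Finset.add_sum_erase _ _ (Finset.mem_univ J),
      scaleOn_spectralPoint hqt.q_ne_zero hrho] at this
    simp only [Pi.sub_apply, Pi.smul_apply, smul_eq_mul, Finset.sum_apply, c, mul_assoc] at this ⊢
    rw [this, add_sub_cancel_right]
  rw [← Submodule.smul_mem_iff _ c_J_ne_zero, recurrence]
  exact sub_mem (Submodule.smul_mem _ _ (esymm_mul_mem_dualSpace hsigma _))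
    (sum_mem fun I hI => term_mem I (Finset.ne_of_mem_erase hI))

theorem eval_mem_dualSpace (hqt : IsGeneric q t) (hR : ∀ lam, IsInterpolation q t lam (R lam))
    {rho : Partitions n} (hrho : ∀ i, rho.1 i ≤ N) :
    (fun lam => eval (spectralPoint q t rho.weight) (R lam)) ∈
      dualSpace q t R N (n * N - rho.size) := by
  induction h_coweight : rho.coweight N using Nat.strong_induction_on generalizing rho with
  | h m ih =>
    subst h_coweight
    by_cases h_rect : rho = Partitions.rect n N
    · subst h_rect
      exact mem_dualSpace.2 ⟨1, IsSymmetric.one, by simp, by simp⟩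
    have shortRows_nonempty : (rho.shortRows N).Nonempty := by
      contrapose! h_rect with h_empty
      refine Subtype.ext (funext fun i => (hrho i).antisymm (not_lt.1 fun h_lt => ?_))
      exact (Finset.filter_eq_empty_iff.1 h_empty) (Finset.mem_univ i) h_lt
    have h_strip := Partitions.isVerticalStrip_grow hrho
    have grow_le : ∀ i, (rho.grow N).1 i ≤ N := fun i => min_le_right _ _
    have size_grow := h_strip.size_eq
    have size_grow_le := Partitions.size_le_of_forall_le grow_le
    have coweight_grow := h_strip.coweight_eq grow_le
    have sum_pos : 0 < ∑ i ∈ rho.shortRows N, ((i : ℕ) + 1) :=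
      Finset.sum_pos (fun i _ => Nat.succ_pos _) shortRows_nonempty
    rw [show n * N - rho.size = n * N - (rho.grow N).size + (rho.shortRows N).card by lia]
    refine eval_mem_dualSpace_of_isVerticalStrip hqt hR h_strip (rho.isUpperSet_shortRows N)
      (ih _ (by lia) grow_le rfl) fun I hI hcard nu hnu => ?_
    have sum_lt := sum_lt_sum_of_isUpperSet (w := fun i : Fin n => (i : ℕ) + 1)
      (fun i j h => Nat.succ_lt_succ h) (fun i => Nat.succ_pos _)
      (rho.isUpperSet_shortRows N) hcard hI
    have coweight_nu := hnu.coweight_eq grow_le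
    have size_nu := hnu.size_eq
    have nu_le : ∀ i, nu.1 i ≤ N := fun i => by
      have := hnu i
      have := grow_le i
      lia
    exact dualSpace_mono (by lia) (ih _ (by lia) nu_le rfl)

end DualSpace

namespace Partitions

variable {n N : ℕ} {mu : Partitions n}

/-- The complement of `μ` in the rectangle `(Nⁿ)`, for `μ` contained in it. -/
def compl (N : ℕ) (mu : Partitions n) : Partitions n :=
  ⟨fun i => N - mu.1 i.rev, fun _ _ h => Nat.sub_le_sub_left (mu.2 (Fin.rev_le_rev.2 h)) N⟩

theorem compl_le (N : ℕ) (mu : Partitions n) (i : Fin n) : (mu.compl N).1 i ≤ N :=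
  Nat.sub_le _ _

theorem size_compl (h : ∀ i, mu.1 i ≤ N) : (mu.compl N).size + mu.size = n * N := by
  rw [size, size, ← Equiv.sum_comp Fin.revPerm mu.1, ← Finset.sum_add_distrib]
  simp [compl, Nat.sub_add_cancel (h _)]

theorem compl_compl (h : ∀ i, mu.1 i ≤ N) : (mu.compl N).compl N = mu :=
  Subtype.ext (funext fun i => by simp [compl, Nat.sub_sub_self (h i)])

theorem size_compl_rect (n N : ℕ) : ((rect n N).compl N).size = 0 := by
  simp [size, compl, rect]

theorem apply_le_size (mu : Partitions n) (i : Fin n) : mu.1 i ≤ mu.size :=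
  Finset.single_le_sum (fun _ _ => Nat.zero_le _) (Finset.mem_univ i)

/-- The weight `(-μₙ, …, -μ₁)`, dual to `μ`. It describes the point `μ̃`. -/
def dualWeight (mu : Partitions n) (i : Fin n) : ℤ := -mu.weight i.rev

end Partitions

section DualPoints

variable {F : Type*} [Field F] {q t : F} {n N : ℕ} {mu : Partitions n}

theorem spectralPoint_rect (hq : q ≠ 0) (n N : ℕ) :
    spectralPoint q t (Partitions.rect n N).weight = q ^ N • spectralPoint q t 0 := by
  rw [← zpow_natCast, ← spectralPoint_add_const hq]
  congr 1
  funext i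
  simp [Partitions.weight, Partitions.rect]

theorem spectralPoint_compl (hq : q ≠ 0) (hmu : ∀ i, mu.1 i ≤ N) :
    spectralPoint q t (mu.compl N).weight = q ^ N • spectralPoint q t mu.dualWeight := by
  rw [← zpow_natCast, ← spectralPoint_add_const hq]
  congr 1
  funext i
  simp [Partitions.weight, Partitions.dualWeight, Partitions.compl, hmu i.rev, sub_eq_neg_add]

theorem spectralPoint_dualWeight (ht : t ≠ 0) (mu : Partitions n) :
    spectralPoint q t mu.dualWeight =
      (t ^ (1 - (n : ℤ)) • (spectralPoint q t mu.weight)⁻¹) ∘ Fin.revPerm := by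
  funext i
  simp only [spectralPoint, Partitions.dualWeight, Function.comp_apply, Pi.smul_apply,
    Pi.inv_apply, smul_eq_mul, Fin.revPerm_apply, mul_inv, ← zpow_neg]
  rw [mul_left_comm, ← zpow_add₀ ht]
  congr 2
  rw [Fin.val_rev]
  omega

end DualPoints

section DualityInRectangle

theorem aeval_aeval_smul_X {σ F A : Type*} [CommRing F] [CommRing A] [Algebra F A] (c : F)
    (v : σ → A) (f : MvPolynomial σ F) :
    aeval v (aeval (c • X : σ → MvPolynomial σ F) f) = aeval (c • v) f := by
  rw [← AlgHom.comp_apply, comp_aeval]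
  congr 2
  funext i
  simp

variable {F : Type*} [Field F] {q t : F} {n N : ℕ} {lam mu : Partitions n}

theorem IsInterpolation.eq_one {R : MvPolynomial (Fin n) F} (hR : IsInterpolation q t lam R)
    (hlam : lam.size = 0) : R = 1 := by
  have eq_C := totalDegree_eq_zero_iff_eq_C.1 (Nat.le_zero.1 (hR.totalDegree_le.trans_eq hlam))
  have exponent_eq_zero : lam.exponent = 0 :=
    Finsupp.degree_eq_zero_iff _ |>.1 (lam.degree_exponent.trans hlam)
  rw [eq_C, ← exponent_eq_zero, hR.coeff_eq_one, map_one]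

variable {R : Partitions n → MvPolynomial (Fin n) F}

theorem eval_rect_ne_zero (hqt : IsGeneric q t) (hR : ∀ lam, IsInterpolation q t lam (R lam))
    (hlam : ∀ i, lam.1 i ≤ N) :
    eval (spectralPoint q t (Partitions.rect n N).weight) (R lam) ≠ 0 := by
  obtain ⟨P, -, -, hP⟩ := mem_dualSpace.1 (eval_mem_dualSpace hqt hR hlam)
  exact left_ne_zero_of_mul (hP lam ▸ (hR lam).eval_self_ne_zero hqt)

theorem exists_isSymmetric_eval_compl_eq (hqt : IsGeneric q t)
    (hR : ∀ lam, IsInterpolation q t lam (R lam)) (hmu : ∀ i, mu.1 i ≤ N) :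
    ∃ Q : MvPolynomial (Fin n) F, Q.IsSymmetric ∧ Q.totalDegree ≤ mu.size ∧
      ∀ kappa : Partitions n, (∀ i, kappa.1 i ≤ N) →
        eval (spectralPoint q t (mu.compl N).weight) (R (kappa.compl N)) =
          eval (spectralPoint q t (Partitions.rect n N).weight) (R (kappa.compl N)) *
            eval (spectralPoint q t kappa.weight) Q := by
  obtain ⟨P, P_symm, P_degree, hP⟩ :=
    mem_dualSpace.1 (eval_mem_dualSpace hqt hR (mu.compl_le N))
  let z : F := (q ^ N)⁻¹ * (t ^ (1 - (n : ℤ)))⁻¹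
  refine ⟨aeval (z • X) P, fun e => ?_, ?_, fun kappa hkappa => ?_⟩
  · have smul_comp : z • X ∘ e = (z • X : Fin n → MvPolynomial (Fin n) F) ∘ e := rfl
    rw [← aeval_X_left_apply (rename e _), aeval_rename, aeval_aeval_smul_X, smul_comp,
      aeval_comp_perm P_symm e]
  · have := Partitions.size_compl hmu
    refine (totalDegree_aeval_le _ (fun i => (totalDegree_smul_le _ _).trans (by simp)) P).trans ?_
    lia
  · have compl_inv : (spectralPoint q t (kappa.compl N).weight)⁻¹ =
        (z • spectralPoint q t kappa.weight) ∘ Fin.revPerm := by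
      funext i
      simp only [z, spectralPoint_compl hqt.q_ne_zero hkappa,
        spectralPoint_dualWeight hqt.t_ne_zero, Pi.inv_apply, Pi.smul_apply, Function.comp_apply,
        smul_eq_mul, mul_inv, inv_inv, mul_assoc]
    rw [hP, compl_inv, ← aeval_eq_eval, ← aeval_eq_eval]
    exact congrArg _ ((aeval_comp_perm P_symm Fin.revPerm _).trans (aeval_aeval_smul_X z _ P).symm)

/-- As a function of `κ̄`, the normalized value of `R_{κᶜ}` at the complement of `μ` has the
vanishing property and the degree that characterize `R_μ` up to a scalar. -/
theorem exists_eval_compl_eq (hqt : IsGeneric q t) (hR : ∀ lam, IsInterpolation q t lam (R lam))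
    (hmu : mu.size ≤ N) :
    ∃ r : F, ∀ kappa : Partitions n, (∀ i, kappa.1 i ≤ N) →
      eval (spectralPoint q t (mu.compl N).weight) (R (kappa.compl N)) =
        eval (spectralPoint q t (Partitions.rect n N).weight) (R (kappa.compl N)) *
          (r * eval (spectralPoint q t kappa.weight) (R mu)) := by
  have mu_le : ∀ i, mu.1 i ≤ N := fun i => (mu.apply_le_size i).trans hmu
  obtain ⟨Q, Q_symm, Q_degree, hQ⟩ := exists_isSymmetric_eval_compl_eq hqt hR mu_le
  have Q_eq_smul := (hR mu).eq_smul hqt Q_symm Q_degree fun kappa hkappa hne => by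
    have kappa_le : ∀ i, kappa.1 i ≤ N := fun i =>
      (kappa.apply_le_size i).trans (hkappa.trans hmu)
    have size_mu := Partitions.size_compl mu_le
    have size_kappa := Partitions.size_compl kappa_le
    have compl_ne : mu.compl N ≠ kappa.compl N := fun h => hne (by
      rw [← Partitions.compl_compl kappa_le, ← h, Partitions.compl_compl mu_le])
    have eval_eq := hQ kappa kappa_le
    rw [(hR _).eval_eq_zero _ (by lia) compl_ne] at eval_eq
    exact (mul_eq_zero.1 eval_eq.symm).resolve_left
      (eval_rect_ne_zero hqt hR (kappa.compl_le N))
  refine ⟨eval (spectralPoint q t mu.weight) Q / eval (spectralPoint q t mu.weight) (R mu),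
    fun kappa hkappa => (hQ kappa hkappa).trans (congrArg _ ?_)⟩
  rw [← smul_eval, ← Q_eq_smul]

theorem eval_compl_mul_eval_rect (hqt : IsGeneric q t)
    (hR : ∀ lam, IsInterpolation q t lam (R lam)) (hlam : ∀ i, lam.1 i ≤ N) (hmu : mu.size ≤ N) :
    eval (spectralPoint q t (mu.compl N).weight) (R lam) *
        eval (spectralPoint q t (Partitions.rect n N).weight) (R mu) =
      eval (spectralPoint q t (lam.compl N).weight) (R mu) *
        eval (spectralPoint q t (Partitions.rect n N).weight) (R lam) := by
  obtain ⟨r, hr⟩ := exists_eval_compl_eq hqt hR hmu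
  have at_rect := hr (Partitions.rect n N) fun _ => le_rfl
  have at_compl := hr (lam.compl N) (lam.compl_le N)
  rw [(hR _).eq_one (Partitions.size_compl_rect n N), map_one, map_one, one_mul] at at_rect
  rw [Partitions.compl_compl hlam] at at_compl
  rw [at_compl]
  linear_combination -(eval (spectralPoint q t (Partitions.rect n N).weight) (R lam) *
    eval (spectralPoint q t (lam.compl N).weight) (R mu)) * at_rect

end DualityInRectangle

section Lines

variable {F : Type*} [CommRing F] {n : ℕ}

/-- The restriction of `f` to the line spanned by `y`, as a polynomial in the coordinate of the
line. -/
noncomputable def onLine (y : Fin n → F) (f : MvPolynomial (Fin n) F) : Polynomial F :=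
  aeval (fun i => Polynomial.C (y i) * Polynomial.X) f

theorem aeval_onLine {K : Type*} [CommRing K] [Algebra F K] (y : Fin n → F)
    (f : MvPolynomial (Fin n) F) (a : K) :
    Polynomial.aeval a (onLine y f) = aeval (a • (algebraMap F K ∘ y)) f := by
  rw [onLine, ← AlgHom.comp_apply, comp_aeval]
  congr 2
  funext i
  simpa using mul_comm _ _

theorem eval_onLine (y : Fin n → F) (f : MvPolynomial (Fin n) F) (r : F) :
    (onLine y f).eval r = eval (r • y) f := by
  rw [← Polynomial.coe_aeval_eq_eval, aeval_onLine, aeval_eq_eval]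
  rfl

end Lines

section PolynomialDuality

variable {F : Type*} [Field F] {q t : F} {n : ℕ} {R : Partitions n → MvPolynomial (Fin n) F}

theorem onLine_spectralPoint_zero_ne_zero (hqt : IsGeneric q t)
    (hR : ∀ lam, IsInterpolation q t lam (R lam)) (lam : Partitions n) :
    onLine (spectralPoint q t 0) (R lam) ≠ 0 := by
  intro h
  refine eval_rect_ne_zero hqt hR lam.apply_le_size ?_
  rw [spectralPoint_rect hqt.q_ne_zero, ← eval_onLine, h, Polynomial.eval_zero]

theorem onLine_dualWeight_mul_onLine_zero (hqt : IsGeneric q t)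
    (hR : ∀ lam, IsInterpolation q t lam (R lam)) (lam mu : Partitions n) :
    onLine (spectralPoint q t mu.dualWeight) (R lam) * onLine (spectralPoint q t 0) (R mu) =
      onLine (spectralPoint q t lam.dualWeight) (R mu) *
        onLine (spectralPoint q t 0) (R lam) := by
  refine Polynomial.eq_of_infinite_eval_eq _ _ (Set.Infinite.mono ?_
    ((Set.Ici_infinite (max lam.size mu.size)).image hqt.pow_injective.injOn))
  rintro _ ⟨N, hN, rfl⟩
  obtain ⟨hlam, hmu⟩ := max_le_iff.1 (Set.mem_Ici.1 hN)
  have lam_le : ∀ i, lam.1 i ≤ N := fun i => (lam.apply_le_size i).trans hlam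
  have mu_le : ∀ i, mu.1 i ≤ N := fun i => (mu.apply_le_size i).trans hmu
  simpa only [Set.mem_ofPred_eq, Polynomial.eval_mul, eval_onLine,
    spectralPoint_compl hqt.q_ne_zero lam_le, spectralPoint_compl hqt.q_ne_zero mu_le,
    spectralPoint_rect hqt.q_ne_zero] using eval_compl_mul_eval_rect hqt hR lam_le hmu

end PolynomialDuality

section Duality

variable {F K : Type*} [Field F] [Field K] [Algebra F K] {q t : F} {a : K} {n : ℕ}

/-- The value at `a y` of `f` divided by its value at `a τ`. For `f = R_λ` this is `K⁺_λ(a y)`. -/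
noncomputable def normalizedValue (q t : F) (a : K) (f : MvPolynomial (Fin n) F)
    (y : Fin n → F) : K :=
  aeval (a • (algebraMap F K ∘ y)) f / aeval (a • (algebraMap F K ∘ spectralPoint q t 0)) f

theorem normalizedValue_dualWeight (ht : t ≠ 0) {f : MvPolynomial (Fin n) F}
    (hf : f.IsSymmetric) (mu : Partitions n) :
    normalizedValue q t a f (spectralPoint q t mu.dualWeight) =
      normalizedValue q t a f (t ^ (1 - (n : ℤ)) • (spectralPoint q t mu.weight)⁻¹) := by
  rw [spectralPoint_dualWeight ht]
  exact congrArg (· / _) (aeval_comp_perm hf Fin.revPerm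
    (a • (algebraMap F K ∘ (t ^ (1 - (n : ℤ)) • (spectralPoint q t mu.weight)⁻¹))))

theorem existsUnique_isInterpolation (hqt : IsGeneric q t) (lam : Partitions n) :
    ∃! R, IsInterpolation q t lam R := by
  obtain ⟨R, hR⟩ := exists_isInterpolation hqt lam
  exact ⟨R, hR, fun R' hR' => hR'.eq hqt hR⟩

variable {R : Partitions n → MvPolynomial (Fin n) F}

theorem aeval_smul_spectralPoint_zero_ne_zero (hqt : IsGeneric q t) (ha : Transcendental F a)
    (hR : ∀ lam, IsInterpolation q t lam (R lam)) (lam : Partitions n) :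
    aeval (a • (algebraMap F K ∘ spectralPoint q t 0)) (R lam) ≠ 0 := by
  rw [← aeval_onLine, ← map_zero (Polynomial.aeval (R := F) a),
    (transcendental_iff_injective.1 ha).ne_iff]
  exact onLine_spectralPoint_zero_ne_zero hqt hR lam

theorem normalizedValue_dualWeight_comm (hqt : IsGeneric q t) (ha : Transcendental F a)
    (hR : ∀ lam, IsInterpolation q t lam (R lam)) (lam mu : Partitions n) :
    normalizedValue q t a (R lam) (spectralPoint q t mu.dualWeight) =
      normalizedValue q t a (R mu) (spectralPoint q t lam.dualWeight) := by
  rw [normalizedValue, normalizedValue, div_eq_div_iff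
    (aeval_smul_spectralPoint_zero_ne_zero hqt ha hR lam)
    (aeval_smul_spectralPoint_zero_ne_zero hqt ha hR mu)]
  simp only [← aeval_onLine, ← map_mul]
  rw [onLine_dualWeight_mul_onLine_zero hqt hR]

end Duality

theorem isGeneric_q_t : IsGeneric q t where
  q_ne_zero := (FaithfulSMul.algebraMap_eq_zero_iff _ _).not.2 (X_ne_zero 0)
  t_ne_zero := (FaithfulSMul.algebraMap_eq_zero_iff _ _).not.2 (X_ne_zero 1)
  eq_zero_of_pow_mul_pow_eq_one k l h := by
    have monomial_eq_one : monomial (Finsupp.single 0 k + Finsupp.single 1 l) (1 : ℚ) =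
        (1 : MvPolynomial (Fin 2) ℚ) := by
      refine FaithfulSMul.algebraMap_injective _ BaseField (Eq.trans ?_ (map_one _).symm)
      rw [← h, q, t, ← map_pow, ← map_pow, ← map_mul, X_pow_eq_monomial, X_pow_eq_monomial,
        monomial_mul, mul_one]
    have exponent_eq_zero := monomial_left_injective one_ne_zero monomial_eq_one
    exact ⟨by simpa using DFunLike.congr_fun exponent_eq_zero 0,
      by simpa using DFunLike.congr_fun exponent_eq_zero 1⟩

theorem transcendental_a : Transcendental BaseField a :=
  transcendental_iff_injective.2 fun f g h => RatFunc.algebraMap_injective BaseField (by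
    simpa [a, ← RatFunc.algebraMap_X, Polynomial.aeval_algebraMap_apply] using h)

section Specialization

variable {n : ℕ} (lam mu : Partitions n)

theorem bar_eq_spectralPoint : bar mu = spectralPoint q t mu.weight :=
  _root_.funext fun i => by rw [bar, tau, spectralPoint, Partitions.weight, zpow_natCast]

variable {lam} in
theorem isSymInterpolation_iff {R : MvPolynomial (Fin n) BaseField} :
    IsSymInterpolation lam R ↔ IsInterpolation q t lam R :=
  ⟨fun h => ⟨h.symmetric, h.degree_le,
      fun mu => bar_eq_spectralPoint mu ▸ h.vanishing mu, h.coeff_eq_one⟩,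
    fun h => ⟨h.isSymmetric, h.totalDegree_le,
      fun mu => bar_eq_spectralPoint mu ▸ h.eval_eq_zero mu, h.coeff_eq_one⟩⟩

theorem isInterpolation_symInterpolation : IsInterpolation q t lam (symInterpolation lam) := by
  have exists_interpolation : ∃ R, IsSymInterpolation lam R :=
    (exists_isInterpolation isGeneric_q_t lam).imp fun _ => isSymInterpolation_iff.2
  rw [symInterpolation, dif_pos exists_interpolation]
  exact isSymInterpolation_iff.1 exists_interpolation.choose_spec

theorem eval_scaleA_symInterpolationK (y : Fin n → BaseField) :
    eval (scaleA y) (symInterpolationK lam) =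
      aeval (a • (algebraMap BaseField BigField ∘ y)) (symInterpolation lam) :=
  eval_map _ _ _

theorem tau_eq_spectralPoint : (tau : Fin n → BaseField) = spectralPoint q t 0 :=
  _root_.funext fun i => by rw [tau, spectralPoint, Pi.zero_apply, zpow_zero, one_mul]

theorem eval_scaleA_Kplus (y : Fin n → BaseField) :
    eval (scaleA y) (Kplus lam) = normalizedValue q t a (symInterpolation lam) y := by
  rw [Kplus, map_mul, eval_C, inv_mul_eq_div, eval_scaleA_symInterpolationK,
    eval_scaleA_symInterpolationK, tau_eq_spectralPoint, normalizedValue]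

theorem tilde_eq_spectralPoint : tilde mu = spectralPoint q t mu.dualWeight := rfl

theorem scaled_bar_inv_eq :
    (fun i => t ^ (1 - (n : ℤ)) * (bar mu i)⁻¹) =
      t ^ (1 - (n : ℤ)) • (spectralPoint q t mu.weight)⁻¹ := by
  rw [bar_eq_spectralPoint]
  rfl

end Specialization

end InterpolationMacdonald

open InterpolationMacdonald MvPolynomial in
theorem mainTheorem4_general {F K : Type*} [Field F] [Field K] [Algebra F K] {q t : F} {a : K}
    (hqt : IsGeneric q t) (ha : Transcendental F a) (n : ℕ) :
    (∀ lam : Partitions n, ∃! R, IsInterpolation q t lam R) ∧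
    ∀ R : Partitions n → MvPolynomial (Fin n) F, (∀ lam, IsInterpolation q t lam (R lam)) →
      (∀ lam, aeval (a • (algebraMap F K ∘ spectralPoint q t 0)) (R lam) ≠ 0) ∧
      ∀ lam mu,
        normalizedValue q t a (R lam) (spectralPoint q t mu.dualWeight) =
          normalizedValue q t a (R mu) (spectralPoint q t lam.dualWeight) ∧
        normalizedValue q t a (R lam) (t ^ (1 - (n : ℤ)) • (spectralPoint q t mu.weight)⁻¹) =
          normalizedValue q t a (R mu) (t ^ (1 - (n : ℤ)) • (spectralPoint q t lam.weight)⁻¹) := by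
  refine ⟨existsUnique_isInterpolation hqt, fun R hR =>
    ⟨aeval_smul_spectralPoint_zero_ne_zero hqt ha hR, fun lam mu =>
      ⟨normalizedValue_dualWeight_comm hqt ha hR lam mu, ?_⟩⟩⟩
  rw [← normalizedValue_dualWeight hqt.t_ne_zero (hR lam).isSymmetric,
    ← normalizedValue_dualWeight hqt.t_ne_zero (hR mu).isSymmetric,
    normalizedValue_dualWeight_comm hqt ha hR]

theorem mainTheorem4 (n : ℕ) :
    (∀ lam : InterpolationMacdonald.Partitions n,
      (∃! R : MvPolynomial (Fin n) InterpolationMacdonald.BaseField,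
        InterpolationMacdonald.IsSymInterpolation lam R) ∧
      MvPolynomial.eval (InterpolationMacdonald.scaleA InterpolationMacdonald.tau)
        (InterpolationMacdonald.symInterpolationK lam) ≠ 0) ∧
    (∀ lam mu : InterpolationMacdonald.Partitions n,
      MvPolynomial.eval
          (InterpolationMacdonald.scaleA (InterpolationMacdonald.tilde mu))
          (InterpolationMacdonald.Kplus lam) =
        MvPolynomial.eval
          (InterpolationMacdonald.scaleA (InterpolationMacdonald.tilde lam))
          (InterpolationMacdonald.Kplus mu) ∧
      MvPolynomial.eval
          (InterpolationMacdonald.scaleA fun i =>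
            InterpolationMacdonald.t ^ (1 - (n : ℤ)) * (InterpolationMacdonald.bar mu i)⁻¹)
          (InterpolationMacdonald.Kplus lam) =
        MvPolynomial.eval
          (InterpolationMacdonald.scaleA fun i =>
            InterpolationMacdonald.t ^ (1 - (n : ℤ)) * (InterpolationMacdonald.bar lam i)⁻¹)
          (InterpolationMacdonald.Kplus mu)) := by
  have ⟨existsUnique, of_isInterpolation⟩ := mainTheorem4_general
    InterpolationMacdonald.isGeneric_q_t InterpolationMacdonald.transcendental_a n
  have ⟨normalizer_ne_zero, duality⟩ :=
    of_isInterpolation _ InterpolationMacdonald.isInterpolation_symInterpolation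
  simpa only [InterpolationMacdonald.isSymInterpolation_iff,
    InterpolationMacdonald.eval_scaleA_Kplus, InterpolationMacdonald.eval_scaleA_symInterpolationK,
    InterpolationMacdonald.tau_eq_spectralPoint, InterpolationMacdonald.tilde_eq_spectralPoint,
    InterpolationMacdonald.scaled_bar_inv_eq]
    using And.intro (fun lam => ⟨existsUnique lam, normalizer_ne_zero lam⟩) duality
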